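/- **Model.** A network consists of $n$ links $l$ with senders $s_l$ and receivers $r_l\ne s_l$ in an arbitrary metric space, transmission powers $P_l>0$ and ambient noise $N\ge 0$; write $\ell_l=d(s_l,r_l)$. Fix a path-loss exponent $\alpha>0$ and a threshold $\beta\ge 1$. When the senders of a set $S$ of links transmit in a slot, the transmission on $l\in S$ is received iff $$\frac{P_l/\ell_l^\alpha}{\sum_{l'\in S\setminus\{l\}}P_{l'}/d(s_{l'},r_l)^\alpha+N}\ \ge\ \beta$$ (a sender located at $r_l$ causes infinite interference). $S$ is feasible if this holds for all $l\in S$. The power assignment is length-monotone if $\ell_v\ge\ell_w$ implies $P_v\ge P_w$, and sub-linear if $\ell_v\ge\ell_w$ implies $P_v/\ell_v^\alpha\le P_w/\ell_w^\alpha$; uniform, linear and mean power are examples. The throughput region $\Lambda$ is the set of vectors $\lambda\ge 0$ in $\mathbb R^n$ that are dominated coordinatewise by a convex combination of indicator vectors of maximal feasible sets. With arrival rates $\lambda$, in every slot a packet arrives at link $l$ with probability $\lambda_l$, independently over links and slots. Queues start empty. A protocol stabilizes the network under $\lambda$ if for every link the expected queue length is bounded uniformly in time; it is $\gamma$-efficient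 for a class of networks if it stabilizes every network of the class under every $\lambda\in\gamma\Lambda$. **Distributed protocols.** All senders run the same randomized protocol on their local state with independent coins. In each slot a sender stays idle, emits a signal, or transmits one of its packets; it then learns only whether its packet was received, whether any sender was emitting (carrier sensing), and whether a packet arrived in its own queue. **The protocol General with the Kesselheim–Vöcking subroutine**, for $n$ links and $\tau\ge1$. Time is divided into periods of $2\tau$ slots. The batch of packets that arrived in a period is handled after the period has ended and all earlier batches are finished. Slots alternate between packet slots and signalling slots. For the batch being handled, the packet slots are divided into phases $k=0,1,2,\dots$ of $\lceil 8\ln n/q_k\rceil$ packet slots, $q_k=\frac1{4\cdot2^k}$; in each packet slot of phase $k$ every undelivered packet of the batch independently asks to be transmitted with probability $q_k$, and each sender with at least one asking packet transmits one of them. In a signalling slot every sender still holding a packet of the batch emits a signal; when the channel is silent, all senders move on to the next batch. **Theorem 1.** For all $\alpha>0$ and $\beta\ge1$ there are constants $K,c>0$ such that for every $n\ge2$ the above fully distributed protocol with $\tau=\lceil K\log^2n\rceil$ is $\frac{c}{\log^2 n}$-efficient for the class of all networks of $n$ links in metric spaces with sub-linear, length-monotone power assignments. That is, for each such network and every $\lambda\in\frac{c}{\log^2n}\Lambda$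 (whose coordinates then lie in $[0,1]$), the expected queue length of every link is bounded uniformly in time. -/

import Mathlib

open scoped ENNReal NNReal Pointwise BigOperators

universe u

noncomputable section

namespace SINR

/-! ### Networks and the physical interference model -/

/-- A network of `n` links in a metric space, with a power assignment and ambient noise. -/
structure Network (X : Type*) [MetricSpace X] (n : ℕ) where
  sender : Fin n → X
  receiver : Fin n → X
  sender_ne_receiver : ∀ l, sender l ≠ receiver l
  power : Fin n → ℝ
  power_pos : ∀ l, 0 < power l
  noise : ℝ
  noise_nonneg : 0 ≤ noise

namespace Network

variable {X : Type*} [MetricSpace X] {n : ℕ}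

/-- The length of a link. -/
def length (net : Network X n) (l : Fin n) : ℝ :=
  dist (net.sender l) (net.receiver l)

/-- Longer links use at least as much power. -/
def LengthMonotone (net : Network X n) : Prop :=
  ∀ v w, net.length w ≤ net.length v → net.power w ≤ net.power v

/-- Longer links receive a signal that is at most as strong. -/
def SubLinear (net : Network X n) (α : ℝ) : Prop :=
  ∀ v w, net.length w ≤ net.length v →
    net.power v / net.length v ^ α ≤ net.power w / net.length w ^ α

/-- The strength at the receiver of link `l` of the signal emitted by the sender of link `l'`.
It is infinite when the two nodes are at the same point. -/
def received (net : Network X n) (α : ℝ) (l' l : Fin n) : ℝ≥0∞ :=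
  ENNReal.ofReal (net.power l') /
    ENNReal.ofReal (dist (net.sender l') (net.receiver l)) ^ α

/-- The signal to interference and noise ratio of link `l` when the senders of the links in `S`
are transmitting. -/
def sinr (net : Network X n) (α : ℝ) (S : Finset (Fin n)) (l : Fin n) : ℝ≥0∞ :=
  net.received α l l / (∑ l' ∈ S \ {l}, net.received α l' l + ENNReal.ofReal net.noise)

/-- The transmission on link `l` is received if the senders of the links in `S` transmit. -/
def Succeeds (net : Network X n) (α β : ℝ) (S : Finset (Fin n)) (l : Fin n) : Prop :=
  ENNReal.ofReal β ≤ net.sinr α S l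

/-- A set of links that can all be scheduled successfully in one slot. -/
def Feasible (net : Network X n) (α β : ℝ) (S : Finset (Fin n)) : Prop :=
  ∀ l ∈ S, net.Succeeds α β S l

/-- The indicator vectors of the maximal feasible sets. -/
def maximalFeasibleVectors (net : Network X n) (α β : ℝ) : Set (Fin n → ℝ) :=
  {x | ∃ S : Finset (Fin n), Maximal (net.Feasible α β) S ∧
    x = Set.indicator (S : Set (Fin n)) 1}

/-- The throughput region (Tassiulas and Ephremides): the rate vectors that are dominated by
a convex combination of indicator vectors of maximal feasible sets. -/
def throughputRegion (net : Network X n) (α β : ℝ) : Set (Fin n → ℝ) :=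
  {r | (∀ l, 0 ≤ r l) ∧ ∃ φ ∈ convexHull ℝ (net.maximalFeasibleVectors α β), r ≤ φ}

end Network

/-! ### Fully distributed protocols with carrier sensing -/

/-- What a sender may do in a slot: stay idle, emit a signal that carries no packet, or transmit
a packet from its queue. -/
inductive Action where
  | idle
  | signal
  | data
  deriving DecidableEq

instance : Fintype Action :=
  ⟨{Action.idle, Action.signal, Action.data}, fun x => by cases x <;> simp⟩

/-- What a sender learns at the end of a slot: whether a packet it transmitted was received,
whether the channel was busy (some sender was emitting), and whether a new packet arrived in
its own queue. -/
structure Feedback where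
  delivered : Bool
  busy : Bool
  arrival : Bool

/-- A fully distributed randomized protocol. Every sender runs the same protocol, on its own
local state and with its own coins; all it ever learns is the feedback. -/
structure Protocol where
  State : Type
  init : State
  act : State → PMF Action
  update : State → Action → Feedback → State

/-- The state of the whole system: the local states of the senders, and the queue lengths. -/
structure Config (A : Protocol) (n : ℕ) where
  state : Fin n → A.State
  queue : Fin n → ℕ

/-- The law of independent random variables with the laws `p l`. -/
def independent {n : ℕ} {E : Type} [Fintype E] (p : Fin n → PMF E) : PMF (Fin n → E) :=
  PMF.ofFintype (fun f => ∏ l, p l (f l)) (by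
    classical
    rw [← Fintype.piFinset_univ, ← Finset.prod_univ_sum]
    refine Finset.prod_eq_one fun l _ => ?_
    rw [← tsum_fintype (L := .unconditional _)]
    exact (p l).tsum_coe)

/-- A coin that shows `true` with probability `p`. -/
def coin (p : unitInterval) : PMF Bool :=
  PMF.ofFintype (fun b => ENNReal.ofReal (if b then (p : ℝ) else 1 - p)) (by
    rw [Fintype.sum_bool, ← ENNReal.ofReal_add] <;> simp [p.2.1, p.2.2])

section Dynamics

variable {X : Type*} [MetricSpace X] {n : ℕ}

open Classical in
/-- The configuration after a slot in which the senders act as in `a` and packets arrive on the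
links `l` with `arr l = true`. -/
def nextConfig (net : Network X n) (α β : ℝ) (A : Protocol) (c : Config A n)
    (a : Fin n → Action) (arr : Fin n → Bool) : Config A n :=
  let S : Finset (Fin n) := Finset.univ.filter fun l => a l ≠ Action.idle
  let delivered : Fin n → Bool := fun l =>
    decide (a l = Action.data ∧ 0 < c.queue l ∧ net.Succeeds α β S l)
  { state := fun l => A.update (c.state l) (a l) ⟨delivered l, decide S.Nonempty, arr l⟩
    queue := fun l =>
      c.queue l - (if delivered l then 1 else 0) + (if arr l then 1 else 0) }

/-- One slot: the senders act independently of each other given their local states, and a packet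
arrives on each link `l` with probability `r l`, independently of everything else. -/
def step (net : Network X n) (α β : ℝ) (A : Protocol) (r : Fin n → unitInterval)
    (c : Config A n) : PMF (Config A n) :=
  (independent fun l => A.act (c.state l)).bind fun a =>
    (independent fun l => coin (r l)).map fun arr => nextConfig net α β A c a arr

/-- The law of the configuration after `t` slots, starting from empty queues. -/
def law (net : Network X n) (α β : ℝ) (A : Protocol) (r : Fin n → unitInterval) :
    ℕ → PMF (Config A n)
  | 0 => PMF.pure ⟨fun _ => A.init, fun _ => 0⟩
  | t + 1 => (law net α β A r t).bind (step net α β A r)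

/-- The expected queue length of link `l` after `t` slots. -/
def expectedQueue (net : Network X n) (α β : ℝ) (A : Protocol) (r : Fin n → unitInterval)
    (t : ℕ) (l : Fin n) : ℝ≥0∞ :=
  ∑' c : Config A n, law net α β A r t c * (c.queue l : ℝ≥0∞)

/-- The protocol keeps the expected queue length of every link bounded for all time, under
independent Bernoulli arrivals with the rates `r`. -/
def Stabilizes (net : Network X n) (α β : ℝ) (A : Protocol) (r : Fin n → unitInterval) : Prop :=
  ∀ l, ∃ B : ℝ≥0, ∀ t, expectedQueue net α β A r t l ≤ B

/-- Every rate vector in the fraction `γ` of the throughput region is a vector of arrival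
probabilities, and the protocol stabilizes the network under it. -/
def StabilizesFraction (net : Network X n) (α β : ℝ) (A : Protocol) (γ : ℝ) : Prop :=
  ∀ r ∈ γ • net.throughputRegion α β,
    ∃ h : ∀ l, r l ∈ unitInterval, Stabilizes net α β A fun l => ⟨r l, h l⟩

end Dynamics

/-- `A` is `γ`-efficient for networks of `n` links in metric spaces (with path-loss exponent `α`
and threshold `β`) and sub-linear, length-monotone power assignments: its efficiency ratio, the
supremum of all such `γ`, is at least `γ`. -/
def IsEfficient (α β : ℝ) (n : ℕ) (A : Protocol) (γ : ℝ) : Prop :=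
  ∀ (X : Type u) [MetricSpace X] (net : Network X n), net.LengthMonotone → net.SubLinear α →
    StabilizesFraction net α β A γ

/-! ### The periodic framework with the contention resolution subroutine -/

/-- The local variables of a sender. -/
structure SenderState where
  /-- number of slots since the start -/
  clock : ℕ
  /-- the period whose packets are being scheduled -/
  s : ℕ
  /-- number of packets in the queue, by the period in which they arrived -/
  pending : ℕ → ℕ
  /-- the phase of the subroutine -/
  k : ℕ
  /-- number of slots of that phase that have passed -/
  j : ℕ

namespace SenderState

/-- The current period, if a period has `2 * τ` slots. -/
def cur (τ : ℕ) (x : SenderState) : ℕ := x.clock / (2 * τ)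

/-- The sender still holds a packet of the period being scheduled, and that period is over. -/
def Active (τ : ℕ) (x : SenderState) : Prop := x.s < x.cur τ ∧ 0 < x.pending x.s

end SenderState

/-- The number of slots of phase `k` of the subroutine: `8 ln n / q` with `q = 1 / (4 * 2 ^ k)`. -/
def phaseLength (n k : ℕ) : ℕ := ⌈8 * Real.log n * (4 * 2 ^ k)⌉₊

/-- Each of `m` packets of a link asks to be transmitted with probability `q = 1 / (4 * 2 ^ k)`,
independently; this is the probability that at least one of them does. -/
def transmitProb (k m : ℕ) : unitInterval :=
  ⟨1 - (1 - 1 / (4 * 2 ^ k)) ^ m, by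
    have h1 : (1 : ℝ) / (4 * 2 ^ k) ≤ 1 := by
      rw [div_le_one (by positivity)]
      have := one_le_pow₀ (n := k) (one_le_two : (1 : ℝ) ≤ 2)
      linarith
    have h0 : (0 : ℝ) ≤ 1 / (4 * 2 ^ k) := by positivity
    have h2 := pow_le_one₀ (n := m) (sub_nonneg.2 h1) (by linarith)
    have h3 := pow_nonneg (sub_nonneg.2 h1) m
    constructor <;> linarith⟩

open Classical in
/-- The periodic framework with period `2 * τ`, for networks of `n` links. The packets that
arrived during a period are scheduled, after the end of that period and after all packets of
earlier periods, by contention resolution with decreasing transmission probabilities.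

Even slots are for packets. In phase `k` every packet of the period being scheduled that is still
in a queue asks to be transmitted with probability `1 / (4 * 2 ^ k)`, and a sender transmits one
packet if one or more of its packets ask for it. Odd slots are for signalling: the senders that
still hold packets of the period being scheduled emit a signal, and when all the senders find the
channel silent they move on to the next period. -/
def general (n τ : ℕ) : Protocol where
  State := SenderState
  init := ⟨0, 0, fun _ => 0, 0, 0⟩
  act x :=
    if x.Active τ then
      if Even x.clock then
        (coin (transmitProb x.k (x.pending x.s))).map
          fun b => if b then Action.data else Action.idle
      else PMF.pure Action.signal
    else PMF.pure Action.idle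
  update x _ fb :=
    let sent : ℕ → ℕ := fun p => if p = x.s ∧ fb.delivered then x.pending p - 1 else x.pending p
    let y : SenderState :=
      { x with
        clock := x.clock + 1
        pending := fun p => if p = x.cur τ ∧ fb.arrival then sent p + 1 else sent p }
    if x.s < x.cur τ then
      if Even x.clock then
        if phaseLength n x.k ≤ x.j + 1 then { y with k := x.k + 1, j := 0 }
        else { y with j := x.j + 1 }
      else if fb.busy then y
      else { y with s := x.s + 1, k := 0, j := 0 }
    else y

end SINR

end

/-!
The proof follows the packets of one period, the batch, through the contention resolution, and then
treats the batches as customers of a single-server queue.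

*Load.* For links `v` and `w`, let `weight v w` be the mutual affectance of the two links if `w` is
the longer one. The load of a batch at `v` is the sum of these weights over its packets. With
sub-linear, length-monotone powers, a feasible set has load `O(log n)` at every link
(`Network.sum_weight_le`): the longer links of the set affect `v` by a constant, because the
senders far from `v` interfere about as much with the link of the set closest to `v`, and those near
`v` interfere with one another so much that they are few; and `v` affects the longer links of the
set by a harmonic sum, because the `i`-th of them in a suitable order tolerates the interference of
`i - 1` senders, each about as strong as that of `v`. The bound is linear in the set, so it
holds for convex combinations. Hence the arrivals of a period of `O(log ^ 2 n)` slots have load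
`O(log n)` in expectation when the rates lie in `c / log ^ 2 n` times the throughput region, and
since arrivals are independent and weights are at most `2`, exponential moments give
`E [∑ v, exp (load v)] ≤ n ^ 2` (`ex_expLoad_le`). The logarithm `I` of this random sum bounds the
load at all links at once.

*Contention resolution.* Ordering each interfering pair by length turns the sum of all affectances
into a sum of loads, so as soon as the asking probability `q` is at most `1 / (2 I)`, a packet slot
delivers a fraction `q / 2` of the remaining packets in expectation (`ex_total_survivors_le`).
A phase from then on reduces their number by a factor `n ^ 4`, which beats the doubling of the phase
lengths, so the batch takes `O(log n * (1 + I))` slots in expectation, and similarly for the third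
moment (`ex_resolution_le`). Averaged over the batch, the service time has mean at most `τ / 16` and
a finite third moment.

*Queueing.* Given all arrivals, the configuration is a function of the arrivals and of the progress
of the current batch (`quenched_general_eq`), and the probability that a batch is unfinished at some
time is bounded by that of the recursion `D ↦ max D (τ * (m + 1)) + r` of completion times, with
service times `r` that are independent given the batches (`ex_progress_le`). As the batches of
different periods are independent, averaging makes the service times independent and identically
distributed (`arrivals_bind_completion`). The function `A ^ 2 / (A + z) ^ 2` is a supersolution of
the recursion for the tail of the delay (`ex_tailBound_le`); it needs only the first and the third
moment of the service time. Its sum over the multiples of `τ` is finite, so the expected number of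
unfinished batches is bounded, and each batch has at most `2 * τ` packets per link.
-/

noncomputable section

namespace SINR

/-! ### Expectations under discrete laws -/

/-- The expectation of a nonnegative function under a discrete law. -/
def ex {A : Type*} (p : PMF A) (f : A → ℝ≥0∞) : ℝ≥0∞ := ∑' a, p a * f a

section Expectation

variable {A B : Type*}

theorem ex_pure (a : A) (f : A → ℝ≥0∞) : ex (PMF.pure a) f = f a := by
  unfold ex
  rw [tsum_eq_single a]
  · simp
  · intro b hb
    simp [PMF.pure_apply, hb]

theorem ex_bind (p : PMF A) (g : A → PMF B) (f : B → ℝ≥0∞) :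
    ex (p.bind g) f = ex p fun a => ex (g a) f := by
  unfold ex
  simp only [PMF.bind_apply, ← ENNReal.tsum_mul_right, ← ENNReal.tsum_mul_left]
  rw [ENNReal.tsum_comm]
  simp only [mul_assoc]

theorem ex_map (p : PMF A) (g : A → B) (f : B → ℝ≥0∞) :
    ex (p.map g) f = ex p fun a => f (g a) := by
  rw [← PMF.bind_pure_comp, ex_bind]
  simp only [Function.comp, ex_pure]

theorem ex_mono_of_support {p : PMF A} {f g : A → ℝ≥0∞} (h : ∀ a ∈ p.support, f a ≤ g a) :
    ex p f ≤ ex p g := by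
  refine ENNReal.tsum_le_tsum fun a => ?_
  by_cases ha : p a = 0
  · simp [ha]
  · exact mul_le_mul_right (h a ((PMF.mem_support_iff _ _).2 ha)) _

theorem ex_mono {p : PMF A} {f g : A → ℝ≥0∞} (h : ∀ a, f a ≤ g a) : ex p f ≤ ex p g :=
  ex_mono_of_support fun a _ => h a

theorem ex_add (p : PMF A) (f g : A → ℝ≥0∞) :
    ex p (fun a => f a + g a) = ex p f + ex p g := by
  simp only [ex, mul_add, ENNReal.tsum_add]

theorem ex_const_mul (p : PMF A) (c : ℝ≥0∞) (f : A → ℝ≥0∞) :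
    ex p (fun a => c * f a) = c * ex p f := by
  simp only [ex, ← ENNReal.tsum_mul_left]
  exact tsum_congr fun a => by ring

theorem ex_const (p : PMF A) (c : ℝ≥0∞) : ex p (fun _ => c) = c := by
  simp only [ex, ENNReal.tsum_mul_right, PMF.tsum_coe, one_mul]

theorem ex_sum {ι : Type*} (s : Finset ι) (p : PMF A) (f : ι → A → ℝ≥0∞) :
    ex p (fun a => ∑ i ∈ s, f i a) = ∑ i ∈ s, ex p (f i) := by
  classical
  induction s using Finset.induction_on with
  | empty => simp [ex]
  | insert i s hi ih => simp only [Finset.sum_insert hi, ex_add, ih]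

theorem ex_comm (p : PMF A) (q : PMF B) (f : A → B → ℝ≥0∞) :
    ex p (fun a => ex q (f a)) = ex q fun b => ex p fun a => f a b := by
  simp only [ex, ← ENNReal.tsum_mul_left]
  rw [ENNReal.tsum_comm]
  exact tsum_congr fun b => tsum_congr fun a => by ring

theorem ex_fintype [Fintype A] (p : PMF A) (f : A → ℝ≥0∞) : ex p f = ∑ a, p a * f a :=
  tsum_fintype _

theorem map_congr_of_support {p : PMF A} {f g : A → B} (h : ∀ a ∈ p.support, f a = g a) :
    p.map f = p.map g := by
  ext b
  simp only [PMF.map_apply]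
  refine tsum_congr fun a => ?_
  by_cases ha : p a = 0
  · simp [ha]
  · rw [h a ((PMF.mem_support_iff _ _).2 ha)]

end Expectation

section Independent

variable {n : ℕ} {E : Type} [Fintype E]

theorem independent_apply (p : Fin n → PMF E) (a : Fin n → E) :
    independent p a = ∏ l, p l (a l) := PMF.ofFintype_apply _ _

theorem mem_support_of_independent {p : Fin n → PMF E} {a : Fin n → E}
    (ha : a ∈ (independent p).support) (l : Fin n) : a l ∈ (p l).support := by
  rw [PMF.mem_support_iff, independent_apply, Finset.prod_ne_zero_iff] at ha
  exact (PMF.mem_support_iff _ _).2 (ha l (Finset.mem_univ l))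

theorem ex_independent_prod (p : Fin n → PMF E) (f : Fin n → E → ℝ≥0∞) :
    ex (independent p) (fun a => ∏ l, f l (a l)) = ∏ l, ex (p l) (f l) := by
  classical
  simp only [ex_fintype, independent_apply, ← Finset.prod_mul_distrib]
  rw [Finset.prod_univ_sum, Fintype.piFinset_univ]

theorem ex_independent_apply (p : Fin n → PMF E) (l : Fin n) (f : E → ℝ≥0∞) :
    ex (independent p) (fun a => f (a l)) = ex (p l) f := by
  classical
  have h := ex_independent_prod p fun i => if i = l then f else fun _ => 1
  have h1 : ∀ a : Fin n → E,
      ∏ i, (if i = l then f else fun _ => 1) (a i) = f (a l) := fun a => by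
    rw [Finset.prod_eq_single l] <;> simp +contextual
  simp only [h1] at h
  rw [h, Finset.prod_eq_single l]
  · simp
  · intro i _ hi
    simp only [hi, if_false, ex_const]
  · simp

theorem ex_independent_apply_mul (p : Fin n → PMF E) {l m : Fin n} (hlm : l ≠ m)
    (f g : E → ℝ≥0∞) :
    ex (independent p) (fun a => f (a l) * g (a m)) = ex (p l) f * ex (p m) g := by
  classical
  have h := ex_independent_prod p fun i => if i = l then f else if i = m then g else fun _ => 1
  have h1 : ∀ F : Fin n → ℝ≥0∞, (∀ i, i ≠ l → i ≠ m → F i = 1) → ∏ i, F i = F l * F m :=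
    fun F hF => by
      rw [← Finset.mul_prod_erase _ _ (Finset.mem_univ l),
        ← Finset.mul_prod_erase _ _ (Finset.mem_erase.2 ⟨hlm.symm, Finset.mem_univ m⟩),
        Finset.prod_eq_one, mul_one]
      intro i hi
      simp only [Finset.mem_erase, Finset.mem_univ, and_true] at hi
      exact hF i hi.2 hi.1
  rw [h1 _ (fun i hl hm => by simp [hl, hm, ex_const])] at h
  simp only [if_true, hlm.symm, if_false] at h
  rw [← h]
  congr 1
  funext a
  rw [h1 _ (fun i hl hm => by simp [hl, hm])]
  simp [hlm.symm]

theorem independent_pure [DecidableEq E] (e : Fin n → E) :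
    (independent fun l => PMF.pure (e l)) = PMF.pure e := by
  ext a
  rw [independent_apply, PMF.pure_apply]
  simp only [PMF.pure_apply]
  by_cases h : a = e
  · simp [h]
  · obtain ⟨l, hl⟩ := Function.ne_iff.1 h
    rw [if_neg h]
    exact Finset.prod_eq_zero (Finset.mem_univ l) (by simp [hl])

theorem coin_true (p : unitInterval) : coin p true = ENNReal.ofReal p := by
  simp [coin]

theorem coin_false (p : unitInterval) : coin p false = ENNReal.ofReal (1 - p) := by
  simp [coin]

end Independent

/-! ### Affectance between links -/

namespace Network

variable {X : Type*} [MetricSpace X] {n : ℕ} (net : Network X n) (α β : ℝ)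

/-- The interference that link `l` tolerates, multiplied by the threshold `β`: the strength of
its signal minus `β` times the noise (zero if the noise alone is too loud). -/
def margin (l : Fin n) : ℝ≥0∞ :=
  net.received α l l - ENNReal.ofReal β * ENNReal.ofReal net.noise

/-- The affectance of link `w` on link `v`: the share of the interference tolerated by `v` that
the sender of `w` uses up, truncated at `1`. -/
def affectance (w v : Fin n) : ℝ≥0∞ :=
  min 1 (ENNReal.ofReal β * net.received α w v / net.margin α β v)

/-- The noise alone does not prevent the reception on link `l`. -/
def Reachable (l : Fin n) : Prop :=
  ENNReal.ofReal β * ENNReal.ofReal net.noise ≤ net.received α l l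

/-- The strict linear order of the links by length, with ties broken by the index. -/
def Shorter (v w : Fin n) : Prop :=
  toLex (net.length v, v) < toLex (net.length w, w)

open Classical in
/-- The weight with which a packet of link `w` counts in the load at link `v`: the mutual
affectance of the two links if `w` is longer than `v`, and nothing if it is shorter. -/
def weight (v w : Fin n) : ℝ≥0∞ :=
  if w = v then 1 else if net.Shorter v w then
    net.affectance α β w v + net.affectance α β v w else 0

variable {net α β}

theorem length_pos (l : Fin n) : 0 < net.length l := dist_pos.2 (net.sender_ne_receiver l)

theorem Shorter.length_le {v w : Fin n} (h : net.Shorter v w) : net.length v ≤ net.length w := by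
  rcases Prod.Lex.toLex_lt_toLex.1 h with h | h
  · exact h.le
  · exact h.1.le

theorem Shorter.not_symm {v w : Fin n} (h : net.Shorter v w) : ¬ net.Shorter w v := by
  unfold Shorter at *
  exact lt_asymm h

theorem shorter_or_shorter {v w : Fin n} (h : v ≠ w) : net.Shorter v w ∨ net.Shorter w v := by
  unfold Shorter
  refine lt_or_gt_of_ne fun h' => h ?_
  simpa using congrArg (fun x => (ofLex x).2) h'

theorem affectance_le_one (w v : Fin n) : net.affectance α β w v ≤ 1 := min_le_left _ _

theorem weight_le_two (v w : Fin n) : net.weight α β v w ≤ 2 := by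
  unfold weight
  split_ifs
  · exact one_le_two
  · exact (add_le_add (affectance_le_one _ _) (affectance_le_one _ _)).trans
      (by norm_num)
  · exact zero_le

theorem received_ne_zero (hα : 0 < α) (w v : Fin n) : net.received α w v ≠ 0 := by
  unfold received
  rw [ENNReal.div_ne_zero]
  exact ⟨by simpa using net.power_pos w,
    ENNReal.rpow_ne_top_of_nonneg hα.le ENNReal.ofReal_ne_top⟩

theorem received_self_eq (l : Fin n) :
    net.received α l l = ENNReal.ofReal (net.power l / net.length l ^ α) := by
  have h := net.length_pos l
  unfold received
  rw [ENNReal.ofReal_div_of_pos (Real.rpow_pos_of_pos h _)]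
  exact congrArg _ (ENNReal.ofReal_rpow_of_pos h)

theorem received_self_ne_top (l : Fin n) : net.received α l l ≠ ⊤ := by
  rw [received_self_eq]
  exact ENNReal.ofReal_ne_top

theorem margin_le_received (l : Fin n) : net.margin α β l ≤ net.received α l l := tsub_le_self

theorem margin_ne_top (l : Fin n) : net.margin α β l ≠ ⊤ :=
  ne_top_of_le_ne_top (received_self_ne_top l) (margin_le_received l)

theorem margin_antitone (hs : net.SubLinear α) {u w : Fin n}
    (h : net.length u ≤ net.length w) : net.margin α β w ≤ net.margin α β u := by
  unfold margin
  rw [received_self_eq, received_self_eq]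
  exact tsub_le_tsub_right (ENNReal.ofReal_le_ofReal (hs w u h)) _

/-- A sender that is at least as strong as another one, and at most three times as far away from its
receiver, is received at most `3 ^ α` times less strongly. -/
theorem received_le_mul_received (hα : 0 < α) {w v w' v' : Fin n}
    (hp : net.power w ≤ net.power w')
    (hd : dist (net.sender w') (net.receiver v') ≤ 3 * dist (net.sender w) (net.receiver v)) :
    net.received α w v ≤ 3 ^ α * net.received α w' v' := by
  unfold received
  set D := ENNReal.ofReal (dist (net.sender w) (net.receiver v)) ^ α with hD
  set D' := ENNReal.ofReal (dist (net.sender w') (net.receiver v')) ^ α with hD'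
  have h3 : (3 : ℝ≥0∞) ^ α ≠ 0 := by simp [ENNReal.rpow_eq_zero_iff]
  have h3' : (3 : ℝ≥0∞) ^ α ≠ ⊤ := ENNReal.rpow_ne_top_of_nonneg hα.le (by simp)
  have hDD : D' ≤ 3 ^ α * D := by
    rw [hD, hD', ← ENNReal.mul_rpow_of_nonneg _ _ hα.le]
    refine ENNReal.rpow_le_rpow ?_ hα.le
    refine (ENNReal.ofReal_le_ofReal hd).trans ?_
    rw [ENNReal.ofReal_mul (by norm_num)]
    simp
  calc ENNReal.ofReal (net.power w) / D
      = 3 ^ α * ENNReal.ofReal (net.power w) / (3 ^ α * D) :=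
        (ENNReal.mul_div_mul_left _ _ h3 h3').symm
    _ ≤ 3 ^ α * ENNReal.ofReal (net.power w') / D' := by
        gcongr
    _ = 3 ^ α * (ENNReal.ofReal (net.power w') / D') := mul_div_assoc _ _ _

theorem Feasible.reachable {S : Finset (Fin n)} (hS : net.Feasible α β S) {w : Fin n}
    (hw : w ∈ S) : net.Reachable α β w := by
  have h : ENNReal.ofReal β ≤ net.sinr α S w := hS w hw
  unfold sinr at h
  refine le_trans ?_ (ENNReal.mul_le_of_le_div h)
  gcongr
  exact le_add_self

theorem Feasible.interference_le_margin {S : Finset (Fin n)} (hS : net.Feasible α β S)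
    {w : Fin n} (hw : w ∈ S) :
    ∑ u ∈ S.erase w, ENNReal.ofReal β * net.received α u w ≤ net.margin α β w := by
  have h : ENNReal.ofReal β ≤ net.sinr α S w := hS w hw
  unfold sinr at h
  have h2 := ENNReal.mul_le_of_le_div h
  rw [mul_add] at h2
  refine ENNReal.le_sub_of_add_le_right (ENNReal.mul_ne_top (by simp) (by simp)) ?_
  rw [← Finset.mul_sum, ← Finset.sdiff_singleton_eq_erase]
  exact h2

/-- The truncated affectances of interferers that stop a transmission sum up to at least `1`. -/
theorem one_le_sum_affectance (hα : 0 < α) {S : Finset (Fin n)} {l : Fin n}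
    (hl : net.Reachable α β l) (hS : ¬ net.Succeeds α β S l) :
    1 ≤ ∑ w ∈ S.erase l, net.affectance α β w l := by
  by_contra! hlt
  apply hS
  have hr0 := received_ne_zero (net := net) hα l l
  have hle : ∀ w ∈ S.erase l, net.affectance α β w l < 1 := fun w hw =>
    (Finset.single_le_sum (f := fun w => net.affectance α β w l) (fun _ _ => zero_le) hw).trans_lt
      hlt
  have heq : ∀ w ∈ S.erase l, net.affectance α β w l =
      ENNReal.ofReal β * net.received α w l / net.margin α β l := fun w hw => by
    refine min_eq_right ?_
    by_contra! h
    have := hle w hw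
    rw [affectance, min_eq_left h.le] at this
    exact lt_irrefl _ this
  have hsum : ∑ w ∈ S.erase l, ENNReal.ofReal β * net.received α w l ≤ net.margin α β l := by
    rw [Finset.sum_congr rfl heq] at hlt
    simp only [div_eq_mul_inv, ← Finset.sum_mul] at hlt
    rw [← div_eq_mul_inv] at hlt
    by_cases h0 : net.margin α β l = 0
    · rw [h0] at hlt ⊢
      by_contra! h
      rw [ENNReal.div_zero h.ne'] at hlt
      simp at hlt
    · simpa using (ENNReal.div_le_iff h0 (margin_ne_top l)).1 hlt.le
  unfold Succeeds sinr
  rw [ENNReal.le_div_iff_mul_le (Or.inr hr0) (Or.inr (received_self_ne_top l)), mul_add,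
    Finset.sdiff_singleton_eq_erase, Finset.mul_sum]
  calc _ ≤ net.margin α β l + ENNReal.ofReal β * ENNReal.ofReal net.noise := by gcongr
    _ = _ := tsub_add_cancel_of_le hl

end Network

/-! ### Affectance within feasible sets -/

/-- If the weight of every element, multiplied by the number of elements that come before it in
some order, is bounded, then the sum of the weights is at most logarithmic. -/
theorem sum_le_harmonic_of_rank {ι : Type*} [DecidableEq ι] (key : ι → ℝ) (x : ι → ℝ≥0∞)
    (M : ℝ≥0∞) (hx : ∀ i, x i ≤ 1) (Q : Finset ι)
    (h : ∀ w ∈ Q, ((Q.filter fun u => u ≠ w ∧ key u ≤ key w).card : ℝ≥0∞) * x w ≤ M) :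
    ∑ w ∈ Q, x w ≤ (M + 1) * ∑ i ∈ Finset.range Q.card, (1 : ℝ≥0∞) / (i + 1 : ℕ) := by
  induction Q using Finset.induction_on_max_value key with
  | empty => simp
  | insert a s has hmax ih =>
    rw [Finset.sum_insert has, Finset.card_insert_of_notMem has, Finset.sum_range_succ, mul_add,
      add_comm]
    refine add_le_add (ih fun w hw => ?_) ?_
    · refine le_trans ?_ (h w (Finset.mem_insert_of_mem hw))
      gcongr
      exact Finset.subset_insert _ _
    · have h1 := h a (Finset.mem_insert_self _ _)
      have h2 : s ⊆ (insert a s).filter fun u => u ≠ a ∧ key u ≤ key a := fun u hu =>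
        Finset.mem_filter.2 ⟨Finset.mem_insert_of_mem hu, fun e => has (e ▸ hu), hmax u hu⟩
      have h3 : (s.card : ℝ≥0∞) * x a ≤ M :=
        le_trans (by gcongr) h1
      rw [mul_one_div, ENNReal.le_div_iff_mul_le (by simp) (by simp)]
      push_cast
      calc x a * (s.card + 1) = s.card * x a + x a := by ring
        _ ≤ M + 1 := add_le_add h3 (hx a)

namespace Network

variable {X : Type*} [MetricSpace X] {n : ℕ} {net : Network X n} {α β : ℝ}

/-- The total affectance that the links of a feasible set have on a link that is not longer than
any of them is bounded. -/
theorem sum_affectance_in_le (hα : 0 < α) (hβ : 1 ≤ β) (hm : net.LengthMonotone)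
    (hs : net.SubLinear α) {T : Finset (Fin n)} {v : Fin n}
    (hv : ∀ w ∈ T, net.length v ≤ net.length w)
    (hT : ∀ w ∈ T, ∑ u ∈ T.erase w, ENNReal.ofReal β * net.received α u w ≤ net.margin α β w) :
    ∑ w ∈ T, net.affectance α β w v ≤ 2 + 2 * 3 ^ α := by
  classical
  rcases T.eq_empty_or_nonempty with rfl | hne
  · simp
  let x : Fin n → ℝ := fun w => dist (net.sender w) (net.receiver v)
  obtain ⟨u, hu, humin⟩ := T.exists_min_image (fun w => x w + net.length w) hne
  have hxv : ∀ w, 0 ≤ x w := fun w => dist_nonneg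
  have hβ1 : 1 ≤ ENNReal.ofReal β := ENNReal.one_le_ofReal.2 hβ
  set m := x u + net.length u with hmdef
  -- The senders that are far from the receiver of `v`, compared with `m`, affect `u` about as
  -- strongly as they affect `v`.
  have hfar : ∑ w ∈ T.filter (fun w => m ≤ 2 * x w), net.affectance α β w v ≤ 1 + 3 ^ α := by
    calc ∑ w ∈ T.filter (fun w => m ≤ 2 * x w), net.affectance α β w v
        ≤ ∑ w ∈ insert u (((T.filter (fun w => m ≤ 2 * x w))).erase u),
            net.affectance α β w v := by
          gcongr
          exact Finset.insert_erase_subset u _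
      _ = net.affectance α β u v +
            ∑ w ∈ (T.filter (fun w => m ≤ 2 * x w)).erase u, net.affectance α β w v :=
          Finset.sum_insert (Finset.notMem_erase _ _)
      _ ≤ 1 + 3 ^ α := by
          refine add_le_add (affectance_le_one _ _) ?_
          calc ∑ w ∈ (T.filter (fun w => m ≤ 2 * x w)).erase u, net.affectance α β w v
              ≤ ∑ w ∈ (T.filter (fun w => m ≤ 2 * x w)).erase u,
                  3 ^ α * (ENNReal.ofReal β * net.received α w u) / net.margin α β v := by
                refine Finset.sum_le_sum fun w hw => ?_
                refine (min_le_right _ _).trans ?_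
                refine ENNReal.div_le_div_right ?_ _
                rw [mul_left_comm]
                gcongr
                refine received_le_mul_received hα le_rfl ?_
                have hw2 := (Finset.mem_filter.1 (Finset.mem_of_mem_erase hw)).2
                have h1 := dist_triangle (net.sender w) (net.receiver v) (net.receiver u)
                have h2 := dist_triangle_left (net.receiver v) (net.receiver u) (net.sender u)
                simp only [x, hmdef, Network.length] at *
                linarith
            _ = 3 ^ α * (∑ w ∈ (T.filter (fun w => m ≤ 2 * x w)).erase u,
                  ENNReal.ofReal β * net.received α w u) / net.margin α β v := by
                simp only [div_eq_mul_inv, Finset.mul_sum, Finset.sum_mul]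
            _ ≤ 3 ^ α * net.margin α β v / net.margin α β v := by
                gcongr
                refine le_trans ?_ ((hT u hu).trans (margin_antitone hs (hv u hu)))
                gcongr
                exact Finset.filter_subset _ _
            _ ≤ 3 ^ α := ENNReal.div_le_of_le_mul le_rfl
  -- The senders that are near the receiver of `v` all belong to long links, and they all
  -- disturb the shortest of these links, so that there are few of them.
  have hnear : ∑ w ∈ T.filter (fun w => ¬ m ≤ 2 * x w), net.affectance α β w v ≤ 1 + 3 ^ α := by
    rcases (T.filter (fun w => ¬ m ≤ 2 * x w)).eq_empty_or_nonempty with he | hBne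
    · rw [he]; simp
    obtain ⟨a, ha, hamin⟩ := (T.filter (fun w => ¬ m ≤ 2 * x w)).exists_min_image net.length hBne
    have haT := (Finset.mem_filter.1 ha).1
    rw [← Finset.add_sum_erase _ _ ha]
    refine add_le_add (affectance_le_one _ _) ?_
    set B := (T.filter (fun w => ¬ m ≤ 2 * x w)).erase a with hB
    have hrec : ∀ w ∈ B, net.margin α β a ≤ 3 ^ α * (ENNReal.ofReal β * net.received α w a) := by
      intro w hw
      have hw' := Finset.mem_of_mem_erase hw
      have hwm := (Finset.mem_filter.1 hw').2
      have ham := (Finset.mem_filter.1 ha).2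
      have hlw := hamin w hw'
      have hua := humin a haT
      calc net.margin α β a ≤ net.received α a a := margin_le_received a
        _ ≤ 3 ^ α * net.received α w a := by
            refine received_le_mul_received hα (hm _ _ hlw) ?_
            have h1 := dist_triangle (net.sender w) (net.receiver v) (net.receiver a)
            have h2 := dist_triangle_left (net.receiver v) (net.receiver a) (net.sender a)
            simp only [x, Network.length, not_le] at *
            linarith
        _ ≤ 3 ^ α * (ENNReal.ofReal β * net.received α w a) := by
            gcongr
            exact le_mul_of_one_le_left (zero_le) hβ1
    by_cases h0 : B = ∅
    · rw [h0]; simp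
    have hsub : B ⊆ T.erase a :=
      Finset.erase_subset_erase _ (Finset.filter_subset _ _)
    have hsumB : ∑ w ∈ B, ENNReal.ofReal β * net.received α w a ≤ net.margin α β a :=
      le_trans (by gcongr) (hT a haT)
    have hma : net.margin α β a ≠ 0 := by
      obtain ⟨w, hw⟩ := Finset.nonempty_iff_ne_empty.2 h0
      intro h
      rw [h, nonpos_iff_eq_zero, Finset.sum_eq_zero_iff] at hsumB
      have := hsumB w hw
      rw [mul_eq_zero] at this
      rcases this with h | h
      · rw [h] at hβ1; simp at hβ1
      · exact received_ne_zero hα _ _ h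
    calc ∑ w ∈ B, net.affectance α β w v ≤ ∑ w ∈ B, 1 :=
          Finset.sum_le_sum fun w _ => affectance_le_one _ _
      _ ≤ ∑ w ∈ B, 3 ^ α * (ENNReal.ofReal β * net.received α w a) / net.margin α β a := by
          refine Finset.sum_le_sum fun w hw => ?_
          rw [ENNReal.le_div_iff_mul_le (Or.inl hma) (Or.inl (margin_ne_top a)), one_mul]
          exact hrec w hw
      _ = 3 ^ α * (∑ w ∈ B, ENNReal.ofReal β * net.received α w a) / net.margin α β a := by
          simp only [div_eq_mul_inv, Finset.mul_sum, Finset.sum_mul]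
      _ ≤ 3 ^ α * net.margin α β a / net.margin α β a := by gcongr
      _ ≤ 3 ^ α := ENNReal.div_le_of_le_mul le_rfl
  rw [← Finset.sum_filter_add_sum_filter_not T (fun w => m ≤ 2 * x w)]
  calc _ ≤ (1 + 3 ^ α) + (1 + 3 ^ α) := add_le_add hfar hnear
    _ = (2 + 2 * 3 ^ α : ℝ≥0∞) := by ring

/-- The total affectance that a link has on the links of a feasible set that are not shorter is at
most logarithmic. It is not bounded: under uniform power a link at the centre of a star can affect
the `i`-th link of a feasible set by an amount of order `1 / i`. -/
theorem sum_affectance_out_le (hα : 0 < α) (hβ : 1 ≤ β) (hm : net.LengthMonotone)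
    (hs : net.SubLinear α) {T : Finset (Fin n)} {v : Fin n}
    (hv : ∀ w ∈ T, net.length v ≤ net.length w)
    (hT : ∀ w ∈ T, ∑ u ∈ T.erase w, ENNReal.ofReal β * net.received α u w ≤ net.margin α β w) :
    ∑ w ∈ T, net.affectance α β v w ≤
      2 * (3 ^ α + 1) * ∑ i ∈ Finset.range n, (1 : ℝ≥0∞) / (i + 1 : ℕ) := by
  classical
  let y : Fin n → ℝ := fun w => dist (net.sender v) (net.receiver w)
  have hβ1 : 1 ≤ ENNReal.ofReal β := ENNReal.one_le_ofReal.2 hβ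
  have key : ∀ (p : Fin n → Prop) [DecidablePred p] (κ : Fin n → ℝ),
      (∀ w ∈ T, p w → ∀ u ∈ T, p u → u ≠ w → κ u ≤ κ w → net.affectance α β v w ≤
        3 ^ α * (ENNReal.ofReal β * net.received α u w) / net.margin α β w) →
      ∑ w ∈ T.filter p, net.affectance α β v w ≤
        (3 ^ α + 1) * ∑ i ∈ Finset.range n, (1 : ℝ≥0∞) / (i + 1 : ℕ) := by
    intro p _ κ hp
    refine (sum_le_harmonic_of_rank κ (fun w => net.affectance α β v w) (3 ^ α)
      (fun w => affectance_le_one _ _) (T.filter p) fun w hw => ?_).trans ?_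
    · obtain ⟨hwT, hpw⟩ := Finset.mem_filter.1 hw
      rw [← nsmul_eq_mul, ← Finset.sum_const]
      set U := (T.filter p).filter fun u => u ≠ w ∧ κ u ≤ κ w with hU
      calc ∑ u ∈ U, net.affectance α β v w
          ≤ ∑ u ∈ U, 3 ^ α * (ENNReal.ofReal β * net.received α u w) / net.margin α β w := by
            refine Finset.sum_le_sum fun u hu => ?_
            simp only [hU, Finset.mem_filter] at hu
            exact hp w hwT hpw u hu.1.1 hu.1.2 hu.2.1 hu.2.2
        _ = 3 ^ α * (∑ u ∈ U, ENNReal.ofReal β * net.received α u w) / net.margin α β w := by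
            simp only [div_eq_mul_inv, Finset.mul_sum, Finset.sum_mul]
        _ ≤ 3 ^ α * net.margin α β w / net.margin α β w := by
            gcongr
            refine le_trans ?_ (hT w hwT)
            gcongr
            intro u hu
            simp only [hU, Finset.mem_filter] at hu
            exact Finset.mem_erase.2 ⟨hu.2.1, hu.1.1⟩
        _ ≤ 3 ^ α := ENNReal.div_le_of_le_mul le_rfl
    · gcongr
      simpa using Finset.card_le_univ (T.filter p)
  have hclose : ∀ w ∈ T, ∀ u ∈ T,
      dist (net.sender u) (net.receiver w) ≤ 3 * y w →
      net.affectance α β v w ≤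
        3 ^ α * (ENNReal.ofReal β * net.received α u w) / net.margin α β w := by
    intro w hw u hu hd
    refine (min_le_right _ _).trans ?_
    refine ENNReal.div_le_div_right ?_ _
    rw [mul_left_comm]
    gcongr
    exact received_le_mul_received hα (hm _ _ (hv u hu)) hd
  have htri : ∀ u w, dist (net.sender u) (net.receiver w) ≤ net.length u + y u + y w := by
    intro u w
    have h1 := dist_triangle (net.sender u) (net.receiver u) (net.receiver w)
    have h2 := dist_triangle_left (net.receiver u) (net.receiver w) (net.sender v)
    simp only [y, Network.length] at *
    linarith
  rw [← Finset.sum_filter_add_sum_filter_not T (fun w => net.length w ≤ y w)]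
  -- Links whose receivers are further from the sender of `v` than their length are ordered by
  -- this distance, and the other links by length.
  have hG := key (fun w => net.length w ≤ y w) y fun w hw hpw u hu hpu _ hκ => by
    refine hclose w hw u hu ((htri u w).trans ?_)
    linarith
  have hB := key (fun w => ¬ net.length w ≤ y w) net.length fun w hw hpw u hu hpu _ hκ => by
    rw [not_le] at hpw hpu
    rcases lt_or_ge (net.length u) (y w) with hlt | hge
    · refine hclose w hw u hu ((htri u w).trans ?_)
      linarith
    · refine (affectance_le_one _ _).trans ?_
      have h3 : (3 : ℝ≥0∞) ^ α ≠ 0 := by simp [ENNReal.rpow_eq_zero_iff]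
      rw [ENNReal.le_div_iff_mul_le, one_mul]
      · calc net.margin α β w ≤ net.margin α β u := margin_antitone hs hκ
          _ ≤ net.received α u u := margin_le_received u
          _ ≤ 3 ^ α * net.received α u w := by
              refine received_le_mul_received hα le_rfl ((htri u w).trans ?_)
              have : dist (net.sender u) (net.receiver u) = net.length u := rfl
              linarith
          _ ≤ 3 ^ α * (ENNReal.ofReal β * net.received α u w) := by
              gcongr
              exact le_mul_of_one_le_left (zero_le) hβ1
      · refine Or.inr (mul_ne_zero h3 (mul_ne_zero (fun h => ?_) (received_ne_zero hα _ _)))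
        rw [h] at hβ1
        simp at hβ1
      · exact Or.inl (margin_ne_top w)
  exact (add_le_add hG hB).trans_eq (by ring)

theorem sum_range_one_div_le {n : ℕ} (hn : 2 ≤ n) :
    ∑ i ∈ Finset.range n, (1 : ℝ≥0∞) / (i + 1 : ℕ) ≤ ENNReal.ofReal (5 / 2 * Real.log n) := by
  have h : ∑ i ∈ Finset.range n, (1 : ℝ≥0∞) / (i + 1 : ℕ) =
      ENNReal.ofReal ((harmonic n : ℚ) : ℝ) := by
    unfold harmonic
    push_cast
    rw [ENNReal.ofReal_sum_of_nonneg (fun i _ => by positivity)]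
    refine Finset.sum_congr rfl fun i _ => ?_
    rw [ENNReal.ofReal_inv_of_pos (by positivity), one_div]
    congr 1
    exact_mod_cast (ENNReal.ofReal_natCast (i + 1)).symm
  rw [h]
  refine ENNReal.ofReal_le_ofReal ((harmonic_le_one_add_log n).trans ?_)
  have h2 : Real.log 2 ≤ Real.log n := Real.log_le_log (by norm_num) (by exact_mod_cast hn)
  have := Real.log_two_gt_d9
  linarith

/-- The load that the links of a feasible set put on a link is at most logarithmic. -/
theorem sum_weight_le (hn : 2 ≤ n) (hα : 0 < α) (hβ : 1 ≤ β) (hm : net.LengthMonotone)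
    (hs : net.SubLinear α) {S : Finset (Fin n)} (hS : net.Feasible α β S) (v : Fin n) :
    ∑ w ∈ S, net.weight α β v w ≤ ENNReal.ofReal (10 * (1 + 3 ^ α) * Real.log n) := by
  classical
  set T := S.filter (net.Shorter v) with hTdef
  have hv : ∀ w ∈ T, net.length v ≤ net.length w := fun w hw =>
    (Finset.mem_filter.1 hw).2.length_le
  have hT : ∀ w ∈ T,
      ∑ u ∈ T.erase w, ENNReal.ofReal β * net.received α u w ≤ net.margin α β w := fun w hw =>
    le_trans (Finset.sum_le_sum_of_subset
      (Finset.erase_subset_erase _ (Finset.filter_subset _ _)))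
      (hS.interference_le_margin (Finset.mem_filter.1 hw).1)
  have h1 : ∑ w ∈ S, net.weight α β v w ≤
      1 + (∑ w ∈ T, net.affectance α β w v + ∑ w ∈ T, net.affectance α β v w) := by
    calc ∑ w ∈ S, net.weight α β v w
        ≤ ∑ w ∈ S, ((if w = v then 1 else 0) + if net.Shorter v w then
            net.affectance α β w v + net.affectance α β v w else 0) := by
          refine Finset.sum_le_sum fun w _ => ?_
          unfold weight
          split_ifs <;> simp
      _ ≤ _ := by
          rw [← Finset.sum_add_distrib (s := T), hTdef, Finset.sum_filter, Finset.sum_add_distrib,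
            Finset.sum_ite_eq']
          gcongr
          split_ifs <;> simp
  have h2 := Real.log_two_gt_d9
  have h3 : Real.log 2 ≤ Real.log n := Real.log_le_log (by norm_num) (by exact_mod_cast hn)
  have h4 : (0 : ℝ) < 3 ^ α := Real.rpow_pos_of_pos (by norm_num) _
  have h5 : (3 : ℝ≥0∞) ^ α = ENNReal.ofReal (3 ^ α) := by
    rw [← ENNReal.ofReal_rpow_of_pos (by norm_num)]
    simp
  refine h1.trans ((add_le_add le_rfl (add_le_add (sum_affectance_in_le hα hβ hm hs hv hT)
    ((sum_affectance_out_le hα hβ hm hs hv hT).trans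
      (mul_le_mul_right (sum_range_one_div_le hn) _)))).trans ?_)
  have h6 : (1 : ℝ≥0∞) + (2 + 2 * 3 ^ α +
      2 * (3 ^ α + 1) * ENNReal.ofReal (5 / 2 * Real.log n)) =
      ENNReal.ofReal (1 + (2 + 2 * 3 ^ α + 2 * (3 ^ α + 1) * (5 / 2 * Real.log n))) := by
    have hl : 0 ≤ Real.log n := by linarith
    rw [ENNReal.ofReal_add (by positivity) (by positivity),
      ENNReal.ofReal_add (by positivity) (by positivity),
      ENNReal.ofReal_add (by positivity) (by positivity),
      ENNReal.ofReal_mul (p := 2 * (3 ^ α + 1)) (by positivity),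
      ENNReal.ofReal_mul (p := 2) (by positivity),
      ENNReal.ofReal_mul (p := 2) (by positivity),
      ENNReal.ofReal_add (by positivity) (by positivity), h5]
    simp
  rw [h6]
  refine ENNReal.ofReal_le_ofReal ?_
  nlinarith

end Network

/-! ### Contention resolution: the drift of one packet slot -/

/-- The law of the action, in a packet slot of phase `k`, of a sender that holds `m` packets of the
batch. -/
def actLaw (k m : ℕ) : PMF Action :=
  if 0 < m then (coin (transmitProb k m)).map fun b => if b then Action.data else Action.idle
  else PMF.pure Action.idle

/-- The indicator of a transmission. -/
def sending (a : Action) : ℝ≥0∞ := if a = Action.data then 1 else 0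

theorem one_sub_pow_le {q : ℝ} (h0 : 0 ≤ q) (h1 : q ≤ 1) (m : ℕ) :
    (1 - q) ^ m ≤ 1 - m * q + (m * q) ^ 2 := by
  induction m with
  | zero => simp
  | succ m ih =>
    rw [pow_succ]
    refine (mul_le_mul_of_nonneg_right ih (by linarith)).trans ?_
    push_cast
    have hm : (0 : ℝ) ≤ m := Nat.cast_nonneg m
    have h2 : 0 ≤ (m : ℝ) ^ 2 * q ^ 2 * q := by positivity
    have h3 : 0 ≤ (m : ℝ) * q ^ 2 := by positivity
    have h4 : 0 ≤ q ^ 2 := by positivity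
    nlinarith

theorem askProb_pos (k : ℕ) : (0 : ℝ) < 1 / (4 * 2 ^ k) := by positivity

theorem askProb_le (k : ℕ) : (1 : ℝ) / (4 * 2 ^ k) ≤ 1 := by
  rw [div_le_one (by positivity)]
  have := one_le_pow₀ (n := k) (one_le_two : (1 : ℝ) ≤ 2)
  linarith

theorem ex_actLaw_sending (k m : ℕ) :
    ex (actLaw k m) sending = ENNReal.ofReal (1 - (1 - 1 / (4 * 2 ^ k)) ^ m) := by
  unfold actLaw
  split_ifs with h
  · rw [ex_map, ex_fintype, Fintype.sum_bool, coin_true, coin_false]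
    simp [sending, transmitProb]
  · obtain rfl : m = 0 := by omega
    simp [ex_pure, sending]

theorem ex_sending_le (k m : ℕ) :
    ex (actLaw k m) sending ≤ ENNReal.ofReal (1 / (4 * 2 ^ k)) * m := by
  rw [ex_actLaw_sending, ← ENNReal.ofReal_natCast, ← ENNReal.ofReal_mul (askProb_pos k).le]
  refine ENNReal.ofReal_le_ofReal ?_
  have h := one_add_mul_le_pow (a := -(1 / (4 * 2 ^ k) : ℝ))
    (by have := askProb_le k; linarith) m
  rw [← sub_eq_add_neg] at h
  linarith

theorem le_ex_sending_add (k m : ℕ) :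
    ENNReal.ofReal (1 / (4 * 2 ^ k)) * m ≤ ex (actLaw k m) sending +
      ENNReal.ofReal (1 / (4 * 2 ^ k)) ^ 2 * (m : ℝ≥0∞) ^ 2 := by
  have h0 := askProb_pos k
  rw [ex_actLaw_sending, ← ENNReal.ofReal_natCast, ← ENNReal.ofReal_mul h0.le,
    ← ENNReal.ofReal_pow h0.le, ← ENNReal.ofReal_pow (by positivity),
    ← ENNReal.ofReal_mul (by positivity), ← ENNReal.ofReal_add _ (by positivity)]
  · refine ENNReal.ofReal_le_ofReal ?_
    have := one_sub_pow_le h0.le (askProb_le k) m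
    nlinarith
  · have h1 := askProb_le k
    have := pow_le_one₀ (n := m) (sub_nonneg.2 h1) (by linarith)
    linarith

/-- The number of packets that are left. -/
def total {n : ℕ} (R : Fin n → ℕ) : ℝ≥0∞ := ∑ l, (R l : ℝ≥0∞)

theorem total_ne_top {n : ℕ} (R : Fin n → ℕ) : total R ≠ ⊤ := by
  simp [total]

theorem one_le_total {n : ℕ} {R : Fin n → ℕ} (h : R ≠ 0) : 1 ≤ total R := by
  obtain ⟨l, hl⟩ := Function.ne_iff.1 h
  have h1 : (1 : ℝ≥0∞) ≤ (R l : ℝ≥0∞) := by exact_mod_cast Nat.one_le_iff_ne_zero.2 hl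
  exact h1.trans (Finset.single_le_sum (f := fun l => (R l : ℝ≥0∞)) (fun _ _ => zero_le)
    (Finset.mem_univ l))

section Contention

variable {X : Type*} [MetricSpace X] {n : ℕ} (net : Network X n) (α β : ℝ)

/-- Link `l` delivers one of its `R l` packets when the senders act as in `a`. -/
def Delivers (R : Fin n → ℕ) (a : Fin n → Action) (l : Fin n) : Prop :=
  a l = Action.data ∧ 0 < R l ∧
    net.Succeeds α β (Finset.univ.filter fun l => a l ≠ Action.idle) l

open Classical in
/-- The numbers of packets that are left after a packet slot. -/
def survivors (R : Fin n → ℕ) (a : Fin n → Action) : Fin n → ℕ := fun l =>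
  R l - if Delivers net α β R a l then 1 else 0

/-- The batch `b` puts a load of at most `I` on every link, and it only has packets that can be
delivered in the absence of interference. -/
def HasLoad (b : Fin n → ℕ) (I : ℝ) : Prop :=
  (∀ l, 0 < b l → net.Reachable α β l) ∧
    ∀ v, ∑ w, (b w : ℝ≥0∞) * net.weight α β v w ≤ ENNReal.ofReal I

variable {net α β}

theorem survivors_le (R : Fin n → ℕ) (a : Fin n → Action) : survivors net α β R a ≤ R :=
  fun _ => Nat.sub_le _ _

theorem HasLoad.mono {b R : Fin n → ℕ} {I : ℝ} (h : HasLoad net α β b I) (hR : R ≤ b) :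
    HasLoad net α β R I := by
  refine ⟨fun l hl => h.1 l (hl.trans_le (hR l)), fun v => le_trans ?_ (h.2 v)⟩
  gcongr with w
  exact hR w

open Classical in
theorem total_survivors_add (R : Fin n → ℕ) (a : Fin n → Action) :
    total (survivors net α β R a) + ∑ l, (if Delivers net α β R a l then 1 else 0 : ℝ≥0∞) =
      total R := by
  unfold total
  rw [← Finset.sum_add_distrib]
  refine Finset.sum_congr rfl fun l _ => ?_
  unfold survivors
  split_ifs with h
  · have := h.2.1
    exact_mod_cast Nat.sub_add_cancel this
  · simp

theorem total_mono {R R' : Fin n → ℕ} (h : R ≤ R') : total R ≤ total R' := by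
  unfold total
  gcongr with l
  exact h l

theorem sum_mutual_affectance_eq (R : Fin n → ℕ) :
    ∑ l, (R l : ℝ≥0∞) ^ 2 + ∑ l, ∑ w ∈ Finset.univ.erase l,
      (R l : ℝ≥0∞) * R w * net.affectance α β w l =
    ∑ v, (R v : ℝ≥0∞) * ∑ w, (R w : ℝ≥0∞) * net.weight α β v w := by
  classical
  have h1 : ∀ l, ∑ w ∈ Finset.univ.erase l, (R l : ℝ≥0∞) * R w * net.affectance α β w l =
      (∑ w, if net.Shorter l w then (R l : ℝ≥0∞) * R w * net.affectance α β w l else 0) +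
        ∑ w, if net.Shorter w l then (R l : ℝ≥0∞) * R w * net.affectance α β w l else 0 := by
    intro l
    rw [← Finset.sum_add_distrib, ← Finset.add_sum_erase _ _ (Finset.mem_univ l)]
    have hl : ¬ net.Shorter l l := fun h => h.not_symm h
    simp only [hl, if_false, add_zero, zero_add]
    refine Finset.sum_congr rfl fun w hw => ?_
    rcases Network.shorter_or_shorter (net := net) (Finset.ne_of_mem_erase hw) with h | h
    · simp [h, h.not_symm]
    · simp [h, h.not_symm]
  simp only [h1, Finset.sum_add_distrib]
  rw [Finset.sum_comm (f := fun l w =>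
    if net.Shorter w l then (R l : ℝ≥0∞) * R w * net.affectance α β w l else 0)]
  rw [← Finset.sum_add_distrib, ← Finset.sum_add_distrib]
  refine Finset.sum_congr rfl fun v _ => ?_
  rw [Finset.mul_sum, ← Finset.sum_add_distrib, ← Finset.add_sum_erase _ _ (Finset.mem_univ v),
    ← Finset.add_sum_erase _ (fun w => (R v : ℝ≥0∞) * (R w * net.weight α β v w))
      (Finset.mem_univ v)]
  have hl : ¬ net.Shorter v v := fun h => h.not_symm h
  simp only [hl, if_false, zero_add]
  congr 1
  · simp [Network.weight, sq]
  · refine Finset.sum_congr rfl fun w hw => ?_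
    simp only [Network.weight, Finset.ne_of_mem_erase hw, if_false]
    split_ifs
    · ring
    · simp

/-- Once the probability `q` of asking is at most `1 / (2 * I)`, where `I` is the load of the
batch, a packet slot delivers a fraction of at least `q / 2` of the packets in expectation: a union
bound over the interferers shows that most of the packets that ask would be received. -/
theorem ex_total_survivors_le (hα : 0 < α) {k : ℕ} {R : Fin n → ℕ} {I : ℝ}
    (hR : HasLoad net α β R I) (hk : I ≤ 2 * 2 ^ k) :
    ex (independent fun l => actLaw k (R l)) (fun a => total (survivors net α β R a)) ≤
      ENNReal.ofReal (1 - 1 / (4 * 2 ^ k) / 2) * total R := by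
  classical
  set P := independent fun l => actLaw k (R l) with hP
  set q : ℝ := 1 / (4 * 2 ^ k) with hq
  have hq0 : 0 < q := askProb_pos k
  have hq1 : q ≤ 1 := askProb_le k
  set p : Fin n → ℝ≥0∞ := fun l => ex (actLaw k (R l)) sending with hp
  set D : Fin n → ℝ≥0∞ := fun l =>
    ex P fun a => if Delivers net α β R a l then 1 else 0 with hD
  have hact : ∀ a ∈ P.support, ∀ l, (a l = Action.data ∧ 0 < R l) ∨ a l = Action.idle := by
    intro a ha l
    have := mem_support_of_independent ha l
    unfold actLaw at this
    split_ifs at this with h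
    · rw [PMF.support_map] at this
      obtain ⟨b, _, hb⟩ := this
      cases b
      · right; simpa using hb.symm
      · left; exact ⟨by simpa using hb.symm, h⟩
    · right; simpa using this
  have hpt : ∀ l, ∀ a ∈ P.support, sending (a l) ≤
      (if Delivers net α β R a l then 1 else 0) + ∑ w ∈ Finset.univ.erase l,
        net.affectance α β w l * (sending (a l) * sending (a w)) := by
    intro l a ha
    rcases hact a ha l with ⟨hl, hRl⟩ | hl
    · split_ifs with hdel
      · simp [sending, hl]
      · have hS : ¬ net.Succeeds α β (Finset.univ.filter fun l => a l ≠ Action.idle) l :=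
          fun h => hdel ⟨hl, hRl, h⟩
        have h1 := Network.one_le_sum_affectance hα (hR.1 l hRl) hS
        have h2 : sending (a l) = 1 := by simp [sending, hl]
        rw [h2, zero_add]
        refine h1.trans ?_
        rw [← Finset.filter_erase, Finset.sum_filter]
        refine Finset.sum_le_sum fun w _ => ?_
        rcases hact a ha w with ⟨hw, _⟩ | hw <;> simp [sending, hw]
    · simp [sending, hl]
  have hpD : ∀ l, p l ≤ D l + ∑ w ∈ Finset.univ.erase l,
      ENNReal.ofReal q ^ 2 * ((R l : ℝ≥0∞) * R w * net.affectance α β w l) := by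
    intro l
    calc p l = ex P fun a => sending (a l) :=
          (ex_independent_apply (fun l => actLaw k (R l)) l sending).symm
      _ ≤ _ := ex_mono_of_support (hpt l)
      _ = D l + ∑ w ∈ Finset.univ.erase l, net.affectance α β w l * (p l * p w) := by
          rw [ex_add, ex_sum]
          congr 1
          refine Finset.sum_congr rfl fun w hw => ?_
          rw [ex_const_mul, hP,
            ex_independent_apply_mul _ (Finset.ne_of_mem_erase hw).symm]
      _ ≤ _ := by
          refine add_le_add le_rfl (Finset.sum_le_sum fun w hw => ?_)
          calc net.affectance α β w l * (p l * p w)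
              ≤ net.affectance α β w l * ((ENNReal.ofReal q * R l) * (ENNReal.ofReal q * R w)) := by
                gcongr
                · exact ex_sending_le k (R l)
                · exact ex_sending_le k (R w)
            _ = _ := by ring
  have htop : ENNReal.ofReal (q / 2) * total R ≠ ⊤ :=
    ENNReal.mul_ne_top ENNReal.ofReal_ne_top (total_ne_top R)
  have hdel : ENNReal.ofReal (q / 2) * total R ≤ ∑ l, D l := by
    have h1 : ENNReal.ofReal q * total R ≤
        ∑ l, D l + ENNReal.ofReal q ^ 2 * (ENNReal.ofReal I * total R) := by
      calc ENNReal.ofReal q * total R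
          = ∑ l, ENNReal.ofReal q * (R l : ℝ≥0∞) := Finset.mul_sum _ _ _
        _ ≤ ∑ l, ((D l + ∑ w ∈ Finset.univ.erase l,
              ENNReal.ofReal q ^ 2 * ((R l : ℝ≥0∞) * R w * net.affectance α β w l)) +
              ENNReal.ofReal q ^ 2 * (R l : ℝ≥0∞) ^ 2) :=
            Finset.sum_le_sum fun l _ =>
              (le_ex_sending_add k (R l)).trans (add_le_add (hpD l) le_rfl)
        _ = ∑ l, D l + ENNReal.ofReal q ^ 2 * (∑ l, (R l : ℝ≥0∞) ^ 2 +
              ∑ l, ∑ w ∈ Finset.univ.erase l,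
                (R l : ℝ≥0∞) * R w * net.affectance α β w l) := by
            simp only [Finset.sum_add_distrib, ← Finset.mul_sum]
            ring
        _ ≤ _ := by
            rw [sum_mutual_affectance_eq]
            gcongr
            unfold total
            rw [Finset.mul_sum]
            refine Finset.sum_le_sum fun v _ => ?_
            rw [mul_comm]
            gcongr
            exact hR.2 v
    have h2 : ENNReal.ofReal q ^ 2 * (ENNReal.ofReal I * total R) ≤
        ENNReal.ofReal (q / 2) * total R := by
      rw [← mul_assoc, ← ENNReal.ofReal_pow hq0.le, ← ENNReal.ofReal_mul (by positivity)]
      gcongr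
      have h3 : q * (4 * 2 ^ k) = 1 := by
        rw [hq]; field_simp
      calc q ^ 2 * I ≤ q ^ 2 * (2 * 2 ^ k) := by gcongr
        _ = q * (q * (4 * 2 ^ k)) / 2 := by ring
        _ = q / 2 := by rw [h3, mul_one]
    have h4 : ENNReal.ofReal q = ENNReal.ofReal (q / 2) + ENNReal.ofReal (q / 2) := by
      rw [← ENNReal.ofReal_add (by positivity) (by positivity), add_halves]
    have h5 := h1.trans (add_le_add le_rfl h2)
    rw [h4, add_mul] at h5
    exact (ENNReal.add_le_add_iff_right htop).1 h5
  have hsum : ex P (fun a => total (survivors net α β R a)) + ∑ l, D l = total R := by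
    rw [hD, ← ex_sum, ← ex_add]
    simp only [total_survivors_add, ex_const]
  refine (ENNReal.add_le_add_iff_right htop).1 ?_
  calc _ ≤ ex P (fun a => total (survivors net α β R a)) + ∑ l, D l := by gcongr
    _ = total R := hsum
    _ = _ := by
      rw [← add_mul, ← ENNReal.ofReal_add (by linarith) (by positivity)]
      simp

end Contention

/-! ### Contention resolution: the number of packet slots for a batch -/

/-- The phase, and the number of slots of that phase that have passed, after one more slot. -/
def nextPhase (n : ℕ) (κ : ℕ × ℕ) : ℕ × ℕ :=
  if phaseLength n κ.1 ≤ κ.2 + 1 then (κ.1 + 1, 0) else (κ.1, κ.2 + 1)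

theorem phaseLength_pos {n : ℕ} (hn : 2 ≤ n) (k : ℕ) : 0 < phaseLength n k := by
  unfold phaseLength
  rw [Nat.ceil_pos]
  have : 0 < Real.log n := Real.log_pos (by exact_mod_cast hn)
  positivity

section Resolution

variable {X : Type*} [MetricSpace X] {n : ℕ} (net : Network X n) (α β : ℝ)

/-- The law of the number of packet slots that the contention resolution takes from the phase `κ`
on when the packets `R` are left, truncated at `N`. An empty batch takes one slot, too. -/
def resolution : ℕ → ℕ × ℕ → (Fin n → ℕ) → PMF ℕ
  | 0, _, _ => PMF.pure 0
  | N + 1, κ, R => (independent fun l => actLaw κ.1 (R l)).bind fun a =>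
      if survivors net α β R a = 0 then PMF.pure 1
      else (resolution N (nextPhase n κ) (survivors net α β R a)).map (· + 1)

variable {net α β}

theorem ex_resolution_succ (N : ℕ) (κ : ℕ × ℕ) (R : Fin n → ℕ) (f : ℕ → ℝ≥0∞) :
    ex (resolution net α β (N + 1) κ R) f = ex (independent fun l => actLaw κ.1 (R l)) fun a =>
      if survivors net α β R a = 0 then f 1
      else ex (resolution net α β N (nextPhase n κ) (survivors net α β R a))
        fun r => f (r + 1) := by
  rw [resolution, ex_bind]
  congr 1
  funext a
  split_ifs
  · rw [ex_pure]
  · rw [ex_map]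

theorem ex_resolution_le_succ (N : ℕ) : ∀ (κ : ℕ × ℕ) (R : Fin n → ℕ) (f : ℕ → ℝ≥0∞),
    Monotone f → ex (resolution net α β N κ R) f ≤ ex (resolution net α β (N + 1) κ R) f := by
  induction N with
  | zero =>
    intro κ R f hf
    rw [ex_resolution_succ, resolution, ex_pure]
    refine (ex_const (independent fun l => actLaw κ.1 (R l)) (f 0)).symm.le.trans
      (ex_mono fun a => ?_)
    split_ifs
    · exact hf zero_le_one
    · rw [resolution, ex_pure]
      exact hf zero_le
  | succ N ih =>
    intro κ R f hf
    rw [ex_resolution_succ, ex_resolution_succ]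
    refine ex_mono fun a => ?_
    split_ifs
    · exact le_rfl
    · exact ih _ _ _ fun r r' h => hf (Nat.succ_le_succ h)

theorem ex_resolution_mono {N N' : ℕ} (h : N ≤ N') (κ : ℕ × ℕ) (R : Fin n → ℕ) {f : ℕ → ℝ≥0∞}
    (hf : Monotone f) : ex (resolution net α β N κ R) f ≤ ex (resolution net α β N' κ R) f := by
  induction h with
  | refl => exact le_rfl
  | step _ ih => exact ih.trans (ex_resolution_le_succ _ _ _ _ hf)

/-- The factor by which a slot of phase `k` reduces the expected number of packets, once the asking
probability is small enough for the load. -/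
def shrink (k : ℕ) : ℝ≥0∞ := ENNReal.ofReal (1 - 1 / (4 * 2 ^ k) / 2)

variable {b : Fin n → ℕ} {I : ℝ} {k₀ : ℕ} {D M ε : ℝ≥0∞} {g φ : ℕ → ℝ≥0∞}

/-- In the phases from `k₀` on, a cost `φ` that grows by at most `g k` in a slot of phase `k` has a
potential: the cost of the rest of the phase, and the number of packets that are expected to be
left at its end, each of which pays for all further phases. -/
theorem ex_resolution_late_le (hn : 2 ≤ n) (hα : 0 < α) (hb : HasLoad net α β b I)
    (hk₀ : I ≤ 2 * 2 ^ k₀) (hε : ∀ k, shrink k ^ phaseLength n k ≤ ε) (hεM : 2 * M * ε ≤ 1)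
    (hg : ∀ k, phaseLength n k * g k ≤ D * M ^ k)
    (hφ : ∀ k e, e < ∑ i ∈ Finset.range (k + 1), phaseLength n i → φ (e + 1) ≤ φ e + g k)
    (N : ℕ) : ∀ (k j : ℕ) (R : Fin n → ℕ) (e : ℕ), k₀ ≤ k → j < phaseLength n k →
      e = ∑ i ∈ Finset.range k, phaseLength n i + j → R ≤ b →
      ex (resolution net α β N (k, j) R) (fun r => φ (e + r)) ≤
        φ e + ((phaseLength n k - j : ℕ) * g k +
          shrink k ^ (phaseLength n k - j) * total R * (2 * (D * M ^ (k + 1)))) := by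
  induction N with
  | zero =>
    intro k j R e _ _ _ _
    rw [resolution, ex_pure]
    exact le_self_add
  | succ N ih =>
    intro k j R e hk hj he hR
    set W : ℝ≥0∞ := 2 * (D * M ^ (k + 1)) with hW
    have hcost : φ (e + 1) ≤ φ e + g k := hφ k e (by rw [Finset.sum_range_succ]; omega)
    have hstep : ∀ a, (if survivors net α β R a = 0 then φ (e + 1) else
        ex (resolution net α β N (nextPhase n (k, j)) (survivors net α β R a))
          fun r => φ (e + (r + 1))) ≤
        (φ e + g k + (phaseLength n k - (j + 1) : ℕ) * g k) +
          (shrink k ^ (phaseLength n k - (j + 1)) * W) * total (survivors net α β R a) := by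
      intro a
      set R' := survivors net α β R a with hR'
      have hR'b : R' ≤ b := (survivors_le R a).trans hR
      split_ifs with h0
      · exact hcost.trans (le_self_add.trans le_self_add)
      · have heq : (fun r => φ (e + (r + 1))) = fun r => φ (e + 1 + r) :=
          funext fun r => congrArg φ (by ring)
        rw [heq]
        rcases Nat.lt_or_ge (j + 1) (phaseLength n k) with hlt | hge
        · have hph : nextPhase n (k, j) = (k, j + 1) := by
            simp only [nextPhase]
            rw [if_neg (not_le.2 hlt)]
          rw [hph]
          refine (ih k (j + 1) R' (e + 1) hk hlt (by omega) hR'b).trans ?_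
          calc _ ≤ (φ e + g k) + ((phaseLength n k - (j + 1) : ℕ) * g k +
                shrink k ^ (phaseLength n k - (j + 1)) * total R' * W) := by gcongr
            _ = _ := by ring
        · have hph : nextPhase n (k, j) = (k + 1, 0) := by
            simp only [nextPhase]
            rw [if_pos hge]
          rw [hph]
          have hsum : e + 1 = ∑ i ∈ Finset.range (k + 1), phaseLength n i + 0 := by
            rw [Finset.sum_range_succ]; omega
          refine (ih (k + 1) 0 R' (e + 1) (by omega) (phaseLength_pos hn _) hsum hR'b).trans ?_
          have hz : phaseLength n k - (j + 1) = 0 := by omega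
          rw [hz, Nat.sub_zero, pow_zero, one_mul, Nat.cast_zero, zero_mul, add_zero]
          refine add_le_add hcost ?_
          have h1 := one_le_total h0
          calc (phaseLength n (k + 1) : ℝ≥0∞) * g (k + 1) +
                shrink (k + 1) ^ phaseLength n (k + 1) * total R' * (2 * (D * M ^ (k + 1 + 1)))
              ≤ D * M ^ (k + 1) + ε * total R' * (2 * (D * M ^ (k + 1 + 1))) :=
                add_le_add (hg _) (mul_le_mul_left (mul_le_mul_left (hε _) _) _)
            _ = D * M ^ (k + 1) + (2 * M * ε) * (D * M ^ (k + 1) * total R') := by ring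
            _ ≤ D * M ^ (k + 1) * total R' + 1 * (D * M ^ (k + 1) * total R') :=
                add_le_add (le_mul_of_one_le_right zero_le h1) (mul_le_mul_left hεM _)
            _ = W * total R' := by rw [hW]; ring
    rw [ex_resolution_succ]
    refine (ex_mono hstep).trans ?_
    rw [ex_add, ex_const, ex_const_mul]
    have hdrift := ex_total_survivors_le (k := k) hα (hb.mono hR)
      (hk₀.trans (by gcongr; exact one_le_two))
    have hpj : phaseLength n k - j = (phaseLength n k - (j + 1)) + 1 := by omega
    calc _ ≤ (φ e + g k + (phaseLength n k - (j + 1) : ℕ) * g k) +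
          (shrink k ^ (phaseLength n k - (j + 1)) * W) * (shrink k * total R) := by
          gcongr
          exact hdrift
      _ = _ := by
          rw [hpj]
          push_cast
          ring

/-- The phases before `k₀` count in full; no progress is needed in them. -/
theorem ex_resolution_early_le (hn : 2 ≤ n) (hα : 0 < α) (hb : HasLoad net α β b I)
    (hk₀ : I ≤ 2 * 2 ^ k₀) (hε : ∀ k, shrink k ^ phaseLength n k ≤ ε) (hεM : 2 * M * ε ≤ 1)
    (hg : ∀ k, phaseLength n k * g k ≤ D * M ^ k)
    (hφ : ∀ k e, e < ∑ i ∈ Finset.range (k + 1), phaseLength n i → φ (e + 1) ≤ φ e + g k)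
    (N : ℕ) : ∀ (k j : ℕ) (R : Fin n → ℕ) (e : ℕ), k < k₀ → j < phaseLength n k →
      e = ∑ i ∈ Finset.range k, phaseLength n i + j → R ≤ b →
      ex (resolution net α β N (k, j) R) (fun r => φ (e + r)) ≤
        φ e + ((phaseLength n k - j : ℕ) * g k + (∑ i ∈ Finset.Ico (k + 1) k₀, D * M ^ i +
          (D * M ^ k₀ + ε * total b * (2 * (D * M ^ (k₀ + 1)))))) := by
  induction N with
  | zero =>
    intro k j R e _ _ _ _
    rw [resolution, ex_pure]
    exact le_self_add
  | succ N ih =>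
    intro k j R e hk hj he hR
    set W : ℝ≥0∞ := D * M ^ k₀ + ε * total b * (2 * (D * M ^ (k₀ + 1))) with hW
    have hcost : φ (e + 1) ≤ φ e + g k := hφ k e (by rw [Finset.sum_range_succ]; omega)
    have hstep : ∀ a, (if survivors net α β R a = 0 then φ (e + 1) else
        ex (resolution net α β N (nextPhase n (k, j)) (survivors net α β R a))
          fun r => φ (e + (r + 1))) ≤
        (φ e + g k) + ((phaseLength n k - (j + 1) : ℕ) * g k +
          (∑ i ∈ Finset.Ico (k + 1) k₀, D * M ^ i + W)) := by
      intro a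
      set R' := survivors net α β R a with hR'
      have hR'b : R' ≤ b := (survivors_le R a).trans hR
      split_ifs with h0
      · exact hcost.trans le_self_add
      · have heq : (fun r => φ (e + (r + 1))) = fun r => φ (e + 1 + r) :=
          funext fun r => congrArg φ (by ring)
        rw [heq]
        rcases Nat.lt_or_ge (j + 1) (phaseLength n k) with hlt | hge
        · have hph : nextPhase n (k, j) = (k, j + 1) := by
            simp only [nextPhase]
            rw [if_neg (not_le.2 hlt)]
          rw [hph]
          exact (ih k (j + 1) R' (e + 1) hk hlt (by omega) hR'b).trans
            (add_le_add hcost le_rfl)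
        · have hph : nextPhase n (k, j) = (k + 1, 0) := by
            simp only [nextPhase]
            rw [if_pos hge]
          rw [hph]
          have hsum : e + 1 = ∑ i ∈ Finset.range (k + 1), phaseLength n i + 0 := by
            rw [Finset.sum_range_succ]; omega
          have hz : phaseLength n k - (j + 1) = 0 := by omega
          rw [hz, Nat.cast_zero, zero_mul, zero_add]
          rcases Nat.lt_or_ge (k + 1) k₀ with hlt' | hge'
          · refine (ih (k + 1) 0 R' (e + 1) hlt' (phaseLength_pos hn _) hsum hR'b).trans ?_
            rw [Finset.sum_eq_sum_Ico_succ_bot hlt', Nat.sub_zero, add_assoc (D * _)]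
            exact add_le_add hcost (add_le_add (hg _) le_rfl)
          · obtain rfl : k + 1 = k₀ := by omega
            refine (ex_resolution_late_le hn hα hb hk₀ hε hεM hg hφ N (k + 1) 0 R' (e + 1) le_rfl
              (phaseLength_pos hn _) hsum hR'b).trans ?_
            rw [Finset.Ico_self, Finset.sum_empty, zero_add, hW, Nat.sub_zero]
            exact add_le_add hcost (add_le_add (hg _)
              (mul_le_mul_left (mul_le_mul' (hε _) (total_mono hR'b)) _))
    rw [ex_resolution_succ]
    refine (ex_mono hstep).trans ?_
    rw [ex_const]
    have hpj : phaseLength n k - j = (phaseLength n k - (j + 1)) + 1 := by omega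
    rw [hpj]
    push_cast
    exact le_of_eq (by ring)

theorem sum_range_mul_pow_le (D M : ℝ≥0∞) (hM : 2 ≤ M) (k : ℕ) :
    ∑ i ∈ Finset.range k, D * M ^ i ≤ D * M ^ k := by
  induction k with
  | zero => simp
  | succ k ih =>
    rw [Finset.sum_range_succ]
    calc _ ≤ D * M ^ k + D * M ^ k := by gcongr
      _ = D * M ^ k * 2 := by ring
      _ ≤ D * M ^ k * M := by gcongr
      _ = _ := by ring

/-- The expected cost of the contention resolution for a batch of load `I ≤ 2 * 2 ^ k₀`. -/
theorem ex_resolution_le (hn : 2 ≤ n) (hα : 0 < α) (hb : HasLoad net α β b I)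
    (hk₀ : I ≤ 2 * 2 ^ k₀) (hε : ∀ k, shrink k ^ phaseLength n k ≤ ε) (hM : 2 ≤ M)
    (hεM : 2 * M * ε ≤ 1) (hg : ∀ k, phaseLength n k * g k ≤ D * M ^ k)
    (hφ : ∀ k e, e < ∑ i ∈ Finset.range (k + 1), phaseLength n i → φ (e + 1) ≤ φ e + g k)
    (N : ℕ) :
    ex (resolution net α β N (0, 0) b) φ ≤
      φ 0 + 2 * (D * M ^ k₀) * (1 + ε * total b * M) := by
  have hpos := phaseLength_pos hn 0
  have h0 : ∀ r : ℕ, φ r = φ (0 + r) := fun r => by rw [zero_add]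
  rw [funext h0]
  rcases Nat.eq_zero_or_pos k₀ with rfl | hk
  · refine (ex_resolution_late_le hn hα hb hk₀ hε hεM hg hφ N 0 0 b 0 le_rfl hpos (by simp)
      le_rfl).trans ?_
    rw [Nat.sub_zero]
    calc _ ≤ φ 0 + (D * M ^ 0 + ε * total b * (2 * (D * M ^ (0 + 1)))) :=
          add_le_add le_rfl (add_le_add (hg 0) (mul_le_mul_left (mul_le_mul_left (hε 0) _) _))
      _ ≤ φ 0 + (2 * (D * M ^ 0) + ε * total b * (2 * (D * M ^ (0 + 1)))) := by
          rw [two_mul (D * M ^ 0)]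
          exact add_le_add le_rfl (add_le_add le_self_add le_rfl)
      _ = _ := by simp only [zero_add]; ring
  · refine (ex_resolution_early_le hn hα hb hk₀ hε hεM hg hφ N 0 0 b 0 hk hpos (by simp)
      le_rfl).trans ?_
    rw [Nat.sub_zero]
    calc _ ≤ φ 0 + (D * M ^ 0 + (∑ i ∈ Finset.Ico (0 + 1) k₀, D * M ^ i +
          (D * M ^ k₀ + ε * total b * (2 * (D * M ^ (k₀ + 1)))))) :=
          add_le_add le_rfl (add_le_add (hg 0) le_rfl)
      _ = φ 0 + (∑ i ∈ Finset.range k₀, D * M ^ i +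
          (D * M ^ k₀ + ε * total b * (2 * (D * M ^ (k₀ + 1))))) := by
          rw [Finset.range_eq_Ico, Finset.sum_eq_sum_Ico_succ_bot hk, add_assoc (D * M ^ 0)]
      _ ≤ φ 0 + (D * M ^ k₀ + (D * M ^ k₀ + ε * total b * (2 * (D * M ^ (k₀ + 1))))) := by
          gcongr
          exact sum_range_mul_pow_le D M hM k₀
      _ = _ := by simp only [zero_add]; ring

end Resolution

/-! ### Sampling the arrivals in advance -/

section Quenched

variable {X : Type*} [MetricSpace X] {n : ℕ} (net : Network X n) (α β : ℝ)

/-- The law of the arrivals of the first `t` slots, with no arrivals afterwards. -/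
def arrivals (r : Fin n → unitInterval) : ℕ → PMF (ℕ → Fin n → Bool)
  | 0 => PMF.pure fun _ _ => false
  | t + 1 => (arrivals r t).bind fun ω =>
      (independent fun l => coin (r l)).map fun arr => Function.update ω t arr

/-- The law of the configuration after `t` slots, given all arrivals. -/
def quenched (A : Protocol) (ω : ℕ → Fin n → Bool) : ℕ → PMF (Config A n)
  | 0 => PMF.pure ⟨fun _ => A.init, fun _ => 0⟩
  | t + 1 => (quenched A ω t).bind fun c =>
      (independent fun l => A.act (c.state l)).map fun a => nextConfig net α β A c a (ω t)

variable {net α β}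

theorem quenched_congr (A : Protocol) {ω ω' : ℕ → Fin n → Bool} {t : ℕ}
    (h : ∀ u < t, ω u = ω' u) : quenched net α β A ω t = quenched net α β A ω' t := by
  induction t with
  | zero => rfl
  | succ t ih =>
    rw [quenched, quenched, ih fun u hu => h u (hu.trans (Nat.lt_succ_self t)),
      h t (Nat.lt_succ_self t)]

/-- All arrivals can be sampled before the protocol starts. -/
theorem law_eq_bind_quenched (A : Protocol) (r : Fin n → unitInterval) (t : ℕ) :
    law net α β A r t = (arrivals r t).bind fun ω => quenched net α β A ω t := by
  induction t with
  | zero => rw [law, arrivals, PMF.pure_bind, quenched]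
  | succ t ih =>
    rw [law, arrivals, ih, PMF.bind_bind, PMF.bind_bind]
    congr 1
    funext ω
    rw [← PMF.bind_pure_comp, PMF.bind_bind]
    simp only [Function.comp_apply, PMF.pure_bind]
    have h : ∀ arr : Fin n → Bool, quenched net α β A (Function.update ω t arr) (t + 1) =
        (quenched net α β A ω t).bind fun c => (independent fun l => A.act (c.state l)).bind
          fun a => PMF.pure (nextConfig net α β A c a arr) := by
      intro arr
      rw [quenched, quenched_congr A (ω := Function.update ω t arr) (ω' := ω)
        (fun u hu => Function.update_of_ne hu.ne _ _), Function.update_self]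
      simp only [← PMF.bind_pure_comp]
      rfl
    simp only [h]
    rw [PMF.bind_comm]
    congr 1
    funext c
    rw [step]
    simp only [← PMF.bind_pure_comp]
    rw [PMF.bind_comm]
    rfl

end Quenched

/-! ### The protocol for given arrivals -/

section Reduction

variable {X : Type*} [MetricSpace X] {n : ℕ} (net : Network X n) (α β : ℝ) (τ : ℕ)

/-- The number of packets that arrive on link `l` in period `p` and before slot `t`. -/
def arrived (ω : ℕ → Fin n → Bool) (p t : ℕ) (l : Fin n) : ℕ :=
  ((Finset.range t).filter fun u => u / (2 * τ) = p ∧ ω u l = true).card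

/-- The packets in the queue of link `l` before slot `t`, by period, if period `s` is being
scheduled. If period `s` is over, `R l` packets of it are left; otherwise `R` is ignored. -/
def pendingAt (ω : ℕ → Fin n → Bool) (t s : ℕ) (R : Fin n → ℕ) (l : Fin n) (p : ℕ) : ℕ :=
  if p < s then 0 else if p = s ∧ s < t / (2 * τ) then R l else arrived τ ω p t l

/-- The configuration before slot `t`, if period `s` is being scheduled and, in case this period
is over, the subroutine is in phase `κ` and `R` gives the packets that are left. -/
def configAt (ω : ℕ → Fin n → Bool) (t s : ℕ) (κ : ℕ × ℕ) (R : Fin n → ℕ) :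
    Config (general n τ) n where
  state l := (⟨t, s, pendingAt τ ω t s R l, if s < t / (2 * τ) then κ.1 else 0,
    if s < t / (2 * τ) then κ.2 else 0⟩ : SenderState)
  queue l := ∑ p ∈ Finset.range (t / (2 * τ) + 1), pendingAt τ ω t s R l p

variable {net α β τ}

theorem arrived_succ (ω : ℕ → Fin n → Bool) (p t : ℕ) (l : Fin n) :
    arrived τ ω p (t + 1) l =
      arrived τ ω p t l + if t / (2 * τ) = p ∧ ω t l = true then 1 else 0 := by
  unfold arrived
  rw [Finset.range_add_one, Finset.filter_insert]
  split_ifs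
  · rw [Finset.card_insert_of_notMem (by simp)]
  · rfl

theorem arrived_of_lt {ω : ℕ → Fin n → Bool} {p t : ℕ} (h : t ≤ 2 * τ * p) (l : Fin n) :
    arrived τ ω p t l = 0 := by
  unfold arrived
  rw [Finset.card_eq_zero, Finset.filter_eq_empty_iff]
  rintro u hu ⟨hp, _⟩
  have h1 := Finset.mem_range.1 hu
  have h2 := Nat.mul_div_le u (2 * τ)
  rw [hp] at h2
  omega

theorem arrived_eq_of_le (hτ : 0 < τ) (ω : ℕ → Fin n → Bool) {p t : ℕ}
    (h : 2 * τ * (p + 1) ≤ t) (l : Fin n) :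
    arrived τ ω p t l = arrived τ ω p (2 * τ * (p + 1)) l := by
  induction h with
  | refl => rfl
  | @step m h ih =>
    rw [arrived_succ, ih, if_neg, add_zero]
    rintro ⟨h1, _⟩
    have h2 : p + 1 ≤ m / (2 * τ) :=
      (Nat.le_div_iff_mul_le (by omega : 0 < 2 * τ)).2 (by rw [mul_comm]; exact h)
    omega

theorem general_update_waiting {x : SenderState} (h : ¬ x.s < x.cur τ) (a : Action)
    (fb : Feedback) : (general n τ).update x a fb = (⟨x.clock + 1, x.s, fun p =>
      if p = x.cur τ ∧ fb.arrival then
        (if p = x.s ∧ fb.delivered then x.pending p - 1 else x.pending p) + 1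
      else if p = x.s ∧ fb.delivered then x.pending p - 1 else x.pending p, x.k, x.j⟩ :
      SenderState) := by
  simp only [general, h, if_false]

theorem general_update_even {x : SenderState} (h : x.s < x.cur τ) (he : Even x.clock) (a : Action)
    (fb : Feedback) : (general n τ).update x a fb = (⟨x.clock + 1, x.s, fun p =>
      if p = x.cur τ ∧ fb.arrival then
        (if p = x.s ∧ fb.delivered then x.pending p - 1 else x.pending p) + 1
      else if p = x.s ∧ fb.delivered then x.pending p - 1 else x.pending p,
      (nextPhase n (x.k, x.j)).1, (nextPhase n (x.k, x.j)).2⟩ : SenderState) := by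
  simp only [general, h, if_true, he, nextPhase]
  split_ifs <;> rfl

theorem general_update_odd {x : SenderState} (h : x.s < x.cur τ) (he : ¬ Even x.clock) (a : Action)
    (fb : Feedback) : (general n τ).update x a fb = (⟨x.clock + 1,
      if fb.busy then x.s else x.s + 1, fun p =>
      if p = x.cur τ ∧ fb.arrival then
        (if p = x.s ∧ fb.delivered then x.pending p - 1 else x.pending p) + 1
      else if p = x.s ∧ fb.delivered then x.pending p - 1 else x.pending p,
      if fb.busy then x.k else 0, if fb.busy then x.j else 0⟩ : SenderState) := by
  simp only [general, h, if_true, he, if_false]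
  split_ifs <;> rfl

theorem sum_range_eq_of_update {f f' : ℕ → ℕ} {m m' s d a : ℕ} (hs : s ≤ m) (hd : d ≤ f s)
    (hm : m ≤ m') (h : ∀ p ≤ m, f' p = f p - (if p = s then d else 0) + if p = m then a else 0)
    (h0 : ∀ p, m < p → p ≤ m' → f' p = 0) :
    ∑ p ∈ Finset.range (m' + 1), f' p = ∑ p ∈ Finset.range (m + 1), f p - d + a := by
  have h1 : ∑ p ∈ Finset.range (m' + 1), f' p = ∑ p ∈ Finset.range (m + 1), f' p := by
    symm
    refine Finset.sum_subset (Finset.range_mono (by omega)) fun p hp hp' => h0 p ?_ ?_ <;>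
      simp only [Finset.mem_range] at hp hp' <;> omega
  have h2 : ∑ p ∈ Finset.range (m + 1), f' p + ∑ p ∈ Finset.range (m + 1), (if p = s then d else 0)
      = ∑ p ∈ Finset.range (m + 1), f p + ∑ p ∈ Finset.range (m + 1), (if p = m then a else 0) := by
    rw [← Finset.sum_add_distrib, ← Finset.sum_add_distrib]
    refine Finset.sum_congr rfl fun p hp => ?_
    rw [h p (by simpa [Nat.lt_succ_iff] using hp)]
    by_cases hps : p = s
    · subst hps; simp; omega
    · simp [hps]
  have h3 : d ≤ ∑ p ∈ Finset.range (m + 1), f p :=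
    hd.trans (Finset.single_le_sum (f := f) (fun _ _ => Nat.zero_le _)
      (Finset.mem_range.2 (by omega)))
  simp only [Finset.sum_ite_eq', Finset.mem_range, Nat.lt_succ_iff, hs, le_refl, if_true] at h2
  rw [h1]
  omega

end Reduction

section SlotEffects

variable {X : Type*} [MetricSpace X] {n : ℕ} {net : Network X n} {α β : ℝ} {τ : ℕ}

theorem even_div (τ u : ℕ) : 2 * u / (2 * τ) = u / τ := Nat.mul_div_mul_left _ _ two_pos

theorem odd_div (τ u : ℕ) : (2 * u + 1) / (2 * τ) = u / τ := by
  rw [← Nat.div_div_eq_div_mul]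
  congr 1
  omega

theorem pendingAt_of_cur_lt (hτ : 0 < τ) (ω : ℕ → Fin n → Bool) {t s p : ℕ} (R : Fin n → ℕ)
    (l : Fin n) (hp : t / (2 * τ) < p) : pendingAt τ ω t s R l p = 0 := by
  unfold pendingAt
  split_ifs with h1 h2
  · rfl
  · omega
  · refine arrived_of_lt ?_ l
    have := (Nat.div_lt_iff_lt_mul (by omega : 0 < 2 * τ)).1 hp
    rw [mul_comm]
    exact this.le

theorem queue_next (hτ : 0 < τ) {ω : ℕ → Fin n → Bool} {t s s' : ℕ} {R R' : Fin n → ℕ}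
    {l : Fin n} {dl arr : Bool}
    (hd : dl = true → s < t / (2 * τ) ∧ 0 < pendingAt τ ω t s R l s)
    (hp : ∀ p, pendingAt τ ω (t + 1) s' R' l p = if p = t / (2 * τ) ∧ arr = true then
        (if p = s ∧ dl = true then pendingAt τ ω t s R l p - 1 else pendingAt τ ω t s R l p) + 1
      else if p = s ∧ dl = true then pendingAt τ ω t s R l p - 1 else pendingAt τ ω t s R l p) :
    ∑ p ∈ Finset.range (t / (2 * τ) + 1), pendingAt τ ω t s R l p - (if dl = true then 1 else 0) +
      (if arr = true then 1 else 0) =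
    ∑ p ∈ Finset.range ((t + 1) / (2 * τ) + 1), pendingAt τ ω (t + 1) s' R' l p := by
  have hm : t / (2 * τ) ≤ (t + 1) / (2 * τ) := Nat.div_le_div_right (Nat.le_succ t)
  have h0 : ∀ p, t / (2 * τ) < p → p ≤ (t + 1) / (2 * τ) →
      pendingAt τ ω (t + 1) s' R' l p = 0 := by
    intro p h1 _
    rw [hp p, pendingAt_of_cur_lt hτ ω R l h1, if_neg (by omega)]
    simp
  cases hdl : dl with
  | false =>
    subst hdl
    refine (sum_range_eq_of_update (s := 0) (Nat.zero_le _) (Nat.zero_le _) hm (fun p _ => ?_)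
      h0).symm
    rw [hp p]
    by_cases h : p = t / (2 * τ) <;> cases arr <;> simp [h]
  | true =>
    obtain ⟨h1, h2⟩ := hd hdl
    subst hdl
    refine (sum_range_eq_of_update (s := s) h1.le h2 hm (fun p _ => ?_) h0).symm
    rw [hp p]
    by_cases h : p = t / (2 * τ)
    · have : p ≠ s := by omega
      cases arr <;> simp [h]
      all_goals (rw [if_neg (by omega), if_neg (by omega)]; simp)
    · by_cases h' : p = s <;> simp [h, h']
      rw [if_neg (by omega), if_neg (by omega), add_zero]

theorem config_ext {A : Protocol} {c c' : Config A n} (h : ∀ l, c.state l = c'.state l)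
    (h' : ∀ l, c.queue l = c'.queue l) : c = c' := by
  obtain ⟨s, q⟩ := c
  obtain ⟨s', q'⟩ := c'
  obtain rfl : s = s' := funext h
  obtain rfl : q = q' := funext h'
  rfl

theorem le_queue (ω : ℕ → Fin n → Bool) {t s : ℕ} (κ : ℕ × ℕ) (R : Fin n → ℕ)
    (hs : s < t / (2 * τ)) (l : Fin n) : R l ≤ (configAt τ ω t s κ R).queue l := by
  have h : pendingAt τ ω t s R l s = R l := by simp [pendingAt, hs]
  rw [← h]
  exact Finset.single_le_sum (f := pendingAt τ ω t s R l) (fun _ _ => Nat.zero_le _)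
    (Finset.mem_range.2 (by omega))

theorem actLaw_support {k m : ℕ} {a : Action} (h : a ∈ (actLaw k m).support) :
    (a = Action.data ∧ 0 < m) ∨ a = Action.idle := by
  unfold actLaw at h
  split_ifs at h with hm
  · rw [PMF.support_map] at h
    obtain ⟨b, _, hb⟩ := h
    cases b
    · right; simpa using hb.symm
    · left; exact ⟨by simpa using hb.symm, hm⟩
  · right; simpa using h

/-- The effect of a packet slot. A sender that transmits holds a packet of the batch, so that its
nonempty queue never delivers a packet of a later period instead. -/
theorem nextConfig_even (hτ : 0 < τ) (ω : ℕ → Fin n → Bool) {u s : ℕ} (hs : s < u / τ)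
    (κ : ℕ × ℕ) (R : Fin n → ℕ) {a : Fin n → Action}
    (ha : a ∈ (independent fun l => actLaw κ.1 (R l)).support) :
    nextConfig net α β (general n τ) (configAt τ ω (2 * u) s κ R) a (ω (2 * u)) =
      configAt τ ω (2 * u + 1) s (nextPhase n κ) (survivors net α β R a) := by
  classical
  have hcur : s < 2 * u / (2 * τ) := by rwa [even_div]
  have hcur' : s < (2 * u + 1) / (2 * τ) := by rwa [odd_div]
  have hdel : ∀ l, (a l = Action.data ∧ 0 < (configAt τ ω (2 * u) s κ R).queue l ∧
      net.Succeeds α β (Finset.univ.filter fun l => a l ≠ Action.idle) l) ↔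
      Delivers net α β R a l := by
    intro l
    unfold Delivers
    refine and_congr_right fun hd => and_congr_left fun _ => ?_
    have hR : 0 < R l := by
      rcases actLaw_support (mem_support_of_independent ha l) with h | h
      · exact h.2
      · rw [hd] at h; cases h
    exact ⟨fun _ => hR, fun _ => hR.trans_le (le_queue ω κ R hcur l)⟩
  have hpend : ∀ l p, pendingAt τ ω (2 * u + 1) s (survivors net α β R a) l p =
      if p = 2 * u / (2 * τ) ∧ ω (2 * u) l = true then
        (if p = s ∧ decide (Delivers net α β R a l) = true then pendingAt τ ω (2 * u) s R l p - 1
          else pendingAt τ ω (2 * u) s R l p) + 1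
      else if p = s ∧ decide (Delivers net α β R a l) = true then
        pendingAt τ ω (2 * u) s R l p - 1 else pendingAt τ ω (2 * u) s R l p := by
    intro l p
    rcases lt_trichotomy p s with h | h | h
    · have h1 : p ≠ 2 * u / (2 * τ) := by omega
      simp [pendingAt, h, h.ne, h1]
    · subst h
      have h1 : p ≠ 2 * u / (2 * τ) := by omega
      simp only [pendingAt, hcur', hcur, h1, survivors, lt_irrefl, if_false, true_and, if_true,
        false_and, decide_eq_true_iff]
      split_ifs <;> simp
    · simp only [pendingAt, h.ne', not_lt.2 h.le, if_false, false_and, arrived_succ,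
        eq_comm (a := p)]
      split_ifs <;> simp
  refine config_ext (fun l => ?_) fun l => ?_
  · refine (general_update_even (x := ⟨2 * u, s, pendingAt τ ω (2 * u) s R l,
      if s < 2 * u / (2 * τ) then κ.1 else 0, if s < 2 * u / (2 * τ) then κ.2 else 0⟩)
      hcur (even_two_mul u) (a l) _).trans ?_
    simp only [configAt, hcur, hcur', if_true]
    refine (SenderState.mk.injEq ..).mpr ⟨rfl, rfl, ?_, rfl, rfl⟩
    funext p
    simp only [hpend l p, SenderState.cur, ← hdel]
    rfl
  · refine Eq.trans ?_ (queue_next hτ (fun h => ⟨hcur, ?_⟩) (hpend l))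
    · simp only [← hdel]
      rfl
    · have := (decide_eq_true_iff.1 h).2.1
      simpa [pendingAt, hcur] using this

/-- The effect of a slot in which the senders wait for the end of the period. If the slot is the
last one of the period, scheduling starts with the arrivals of this period. -/
theorem nextConfig_idle (hτ : 0 < τ) (ω : ℕ → Fin n → Bool) {t s : ℕ}
    (hs : s = t / (2 * τ)) (κ : ℕ × ℕ) (R : Fin n → ℕ) {κ' : ℕ × ℕ} {R' : Fin n → ℕ}
    (hκ' : s < (t + 1) / (2 * τ) → κ' = (0, 0))
    (hR' : s < (t + 1) / (2 * τ) → R' = arrived τ ω s (t + 1)) :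
    nextConfig net α β (general n τ) (configAt τ ω t s κ R) (fun _ => Action.idle) (ω t) =
      configAt τ ω (t + 1) s κ' R' := by
  have hcur : ¬ s < t / (2 * τ) := by omega
  have hpend : ∀ l p, pendingAt τ ω (t + 1) s R' l p =
      if p = t / (2 * τ) ∧ ω t l = true then
        (if p = s ∧ false = true then pendingAt τ ω t s R l p - 1
          else pendingAt τ ω t s R l p) + 1
      else if p = s ∧ false = true then
        pendingAt τ ω t s R l p - 1 else pendingAt τ ω t s R l p := by
    intro l p
    have hR'' : p = s ∧ s < (t + 1) / (2 * τ) → R' l = arrived τ ω p (t + 1) l := fun h => by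
      rw [hR' h.2, h.1]
    have h1 : pendingAt τ ω (t + 1) s R' l p = if p < s then 0 else arrived τ ω p (t + 1) l := by
      unfold pendingAt
      split_ifs with h h'
      · rfl
      · exact hR'' h'
      · rfl
    rw [h1]
    simp only [pendingAt, hcur, and_false, if_false, arrived_succ, eq_comm (a := p),
      Bool.false_eq_true]
    by_cases h : p < s
    · have h2 : t / (2 * τ) ≠ p := by omega
      simp [h, h2]
    · simp only [h, if_false]
      split_ifs <;> simp
  refine config_ext (fun l => ?_) fun l => ?_
  · refine (general_update_waiting (x := ⟨t, s, pendingAt τ ω t s R l,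
      if s < t / (2 * τ) then κ.1 else 0, if s < t / (2 * τ) then κ.2 else 0⟩)
      hcur Action.idle _).trans ?_
    simp only [configAt, hcur, if_false]
    refine (SenderState.mk.injEq ..).mpr ⟨rfl, rfl, ?_, ?_, ?_⟩
    · funext p
      rw [hpend l p]
      simp [SenderState.cur]
    · split_ifs with h
      · rw [hκ' h]
      · rfl
    · split_ifs with h
      · rw [hκ' h]
      · rfl
  · refine Eq.trans ?_ (queue_next (dl := false) hτ (fun h => by cases h) (hpend l))
    simp only [nextConfig]
    simp
    rfl

/-- The action in a signalling slot of a sender that holds `m` packets of the batch. -/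
def signalIf (m : ℕ) : Action := if 0 < m then Action.signal else Action.idle

/-- The effect of a signalling slot: the channel is silent exactly if the batch is finished. -/
theorem nextConfig_odd (hτ : 0 < τ) (ω : ℕ → Fin n → Bool) {u s : ℕ} (hs : s < u / τ)
    (κ : ℕ × ℕ) (R : Fin n → ℕ) :
    nextConfig net α β (general n τ) (configAt τ ω (2 * u + 1) s κ R) (fun l => signalIf (R l))
      (ω (2 * u + 1)) =
      if R = 0 then configAt τ ω (2 * u + 2) (s + 1) (0, 0) (arrived τ ω (s + 1) (2 * u + 2))
      else configAt τ ω (2 * u + 2) s κ R := by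
  classical
  have hcur : s < (2 * u + 1) / (2 * τ) := by rwa [odd_div]
  have hcur' : s < (2 * u + 2) / (2 * τ) := hcur.trans_le (Nat.div_le_div_right (Nat.le_succ _))
  have hodd : ¬ Even (2 * u + 1) := by simp
  have hbusy : (Finset.univ.filter fun l => signalIf (R l) ≠ Action.idle).Nonempty ↔ R ≠ 0 := by
    rw [Function.ne_iff]
    simp only [Finset.Nonempty, Finset.mem_filter, Finset.mem_univ, true_and]
    refine exists_congr fun l => ?_
    unfold signalIf
    split_ifs with h
    · simp [h.ne']
    · simp only [ne_eq, not_true_eq_false, false_iff, Pi.zero_apply, not_not]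
      omega
  have hdata : ∀ l, signalIf (R l) ≠ Action.data := fun l => by
    unfold signalIf
    split_ifs <;> simp
  have hpend : ∀ (s' : ℕ) (R' : Fin n → ℕ) (_ : s' = s ∧ R' = R ∨ s' = s + 1 ∧ R = 0 ∧
      R' = arrived τ ω (s + 1) (2 * u + 2)) (l : Fin n) (p : ℕ),
      pendingAt τ ω (2 * u + 2) s' R' l p =
      if p = (2 * u + 1) / (2 * τ) ∧ ω (2 * u + 1) l = true then
        (if p = s ∧ false = true then pendingAt τ ω (2 * u + 1) s R l p - 1
          else pendingAt τ ω (2 * u + 1) s R l p) + 1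
      else if p = s ∧ false = true then
        pendingAt τ ω (2 * u + 1) s R l p - 1 else pendingAt τ ω (2 * u + 1) s R l p := by
    intro s' R' h l p
    simp only [Bool.false_eq_true, and_false, if_false]
    have hgt : s < p → pendingAt τ ω (2 * u + 2) s' R' l p = arrived τ ω p (2 * u + 1 + 1) l := by
      intro hp
      rcases h with ⟨rfl, rfl⟩ | ⟨rfl, _, rfl⟩
      · unfold pendingAt
        rw [if_neg (by omega), if_neg (by omega)]
      · unfold pendingAt
        rw [if_neg (by omega)]
        split_ifs with h'
        · rw [h'.1]
        · rfl
    rcases lt_trichotomy p s with hp | hp | hp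
    · have h1 : p ≠ (2 * u + 1) / (2 * τ) := by omega
      have h2 : p < s' := by omega
      simp [pendingAt, hp, h1, h2]
    · subst hp
      have h1 : p ≠ (2 * u + 1) / (2 * τ) := by omega
      rcases h with ⟨rfl, rfl⟩ | ⟨rfl, h0, rfl⟩
      · simp [pendingAt, h1, hcur, hcur']
      · simp [pendingAt, h1, hcur, h0]
    · rw [hgt hp, arrived_succ]
      simp only [pendingAt, hp.ne', not_lt.2 hp.le, if_false, false_and, eq_comm (a := p)]
      split_ifs <;> simp
  have key : ∀ (s' : ℕ) (κ' : ℕ × ℕ) (R' : Fin n → ℕ) (_ : s' = s ∧ R' = R ∨ s' = s + 1 ∧ R = 0 ∧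
      R' = arrived τ ω (s + 1) (2 * u + 2)) (_ : s' = if R = 0 then s + 1 else s)
      (_ : κ' = if R = 0 then (0, 0) else κ),
      nextConfig net α β (general n τ) (configAt τ ω (2 * u + 1) s κ R) (fun l => signalIf (R l))
      (ω (2 * u + 1)) = configAt τ ω (2 * u + 2) s' κ' R' := by
    intro s' κ' R' h hs' hκ'
    refine config_ext (fun l => ?_) fun l => ?_
    · refine (general_update_odd (x := ⟨2 * u + 1, s, pendingAt τ ω (2 * u + 1) s R l,
        if s < (2 * u + 1) / (2 * τ) then κ.1 else 0,
        if s < (2 * u + 1) / (2 * τ) then κ.2 else 0⟩) hcur hodd (signalIf (R l)) _).trans ?_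
      simp only [configAt, hcur, if_true, hbusy, hdata, false_and, decide_false]
      refine (SenderState.mk.injEq ..).mpr ⟨rfl, ?_, ?_, ?_, ?_⟩
      · rw [hs']
        by_cases h0 : R = 0 <;> simp [h0]
      · funext p
        rw [hpend s' R' h l p]
        simp [SenderState.cur]
      · rw [hκ']
        by_cases h0 : R = 0 <;> simp [h0, hs', hcur']
      · rw [hκ']
        by_cases h0 : R = 0 <;> simp [h0, hs', hcur']
    · refine Eq.trans ?_ (queue_next (dl := false) hτ (fun h => by cases h) (hpend s' R' h l))
      simp only [nextConfig]
      simp [hdata]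
      rfl
  split_ifs with h0
  · exact key _ _ _ (Or.inr ⟨rfl, h0, rfl⟩) (by simp [h0]) (by simp [h0])
  · exact key _ _ _ (Or.inl ⟨rfl, rfl⟩) (by simp [h0]) (by simp [h0])

end SlotEffects

/-! ### The progress of the schedule -/

section Schedule

variable {X : Type*} [MetricSpace X] {n : ℕ} (net : Network X n) (α β : ℝ) (τ : ℕ)

/-- What the configuration does not owe to the arrivals and the clock: the period that is being
scheduled, the phase of the subroutine, and the packets of the period that are left. -/
abbrev Progress (n : ℕ) : Type := ℕ × (ℕ × ℕ) × (Fin n → ℕ)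

/-- A packet slot `2 * u` and the signalling slot that follows it, given all arrivals. -/
def progressStep (ω : ℕ → Fin n → Bool) (u : ℕ) (c : Progress n) : PMF (Progress n) :=
  if c.1 < u / τ then
    (independent fun l => actLaw c.2.1.1 (c.2.2 l)).map fun a =>
      if survivors net α β c.2.2 a = 0 then (c.1 + 1, (0, 0), arrived τ ω (c.1 + 1) (2 * u + 2))
      else (c.1, nextPhase n c.2.1, survivors net α β c.2.2 a)
  else PMF.pure (c.1, (0, 0), arrived τ ω c.1 (2 * u + 2))

/-- The law of the progress after `2 * u` slots, given all arrivals. -/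
def progress (ω : ℕ → Fin n → Bool) : ℕ → PMF (Progress n)
  | 0 => PMF.pure (0, (0, 0), 0)
  | u + 1 => (progress ω u).bind (progressStep net α β τ ω u)

variable {net α β τ}

theorem arrived_le (hτ : 0 < τ) (ω : ℕ → Fin n → Bool) (p t : ℕ) (l : Fin n) :
    arrived τ ω p t l ≤ 2 * τ := by
  unfold arrived
  calc _ ≤ (Finset.Ico (2 * τ * p) (2 * τ * p + 2 * τ)).card := by
        refine Finset.card_le_card fun u hu => ?_
        obtain ⟨_, hu, _⟩ := Finset.mem_filter.1 hu
        have h1 := Nat.mul_div_le u (2 * τ)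
        have h2 := Nat.lt_mul_div_succ u (by omega : 0 < 2 * τ)
        rw [hu] at h1 h2
        rw [mul_add, mul_one] at h2
        exact Finset.mem_Ico.2 ⟨h1, h2⟩
    _ = 2 * τ := by simp

theorem progress_support (hτ : 0 < τ) (ω : ℕ → Fin n → Bool) (u : ℕ) :
    ∀ c ∈ (progress net α β τ ω u).support, c.1 ≤ u / τ ∧ ∀ l, c.2.2 l ≤ 2 * τ := by
  induction u with
  | zero =>
    intro c hc
    rw [progress, PMF.mem_support_pure_iff] at hc
    subst hc
    simp
  | succ u ih =>
    intro c hc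
    rw [progress, PMF.mem_support_bind_iff] at hc
    obtain ⟨d, hd, hc⟩ := hc
    obtain ⟨h1, h2⟩ := ih d hd
    have hle : u / τ ≤ (u + 1) / τ := Nat.div_le_div_right (Nat.le_succ u)
    unfold progressStep at hc
    split_ifs at hc with h
    · rw [PMF.support_map] at hc
      obtain ⟨a, _, rfl⟩ := hc
      dsimp only
      split_ifs with h0
      · exact ⟨(Nat.succ_le_of_lt h).trans hle, fun l => arrived_le hτ _ _ _ _⟩
      · exact ⟨h1.trans hle, fun l => (survivors_le _ _ l).trans (h2 l)⟩
    · rw [PMF.mem_support_pure_iff] at hc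
      subst hc
      exact ⟨h1.trans hle, fun l => arrived_le hτ _ _ _ _⟩

theorem bind_congr_of_support {A B : Type*} {p : PMF A} {f g : A → PMF B}
    (h : ∀ a ∈ p.support, f a = g a) : p.bind f = p.bind g := by
  ext b
  simp only [PMF.bind_apply]
  refine tsum_congr fun a => ?_
  by_cases ha : p a = 0
  · simp [ha]
  · rw [h a ((PMF.mem_support_iff _ _).2 ha)]

theorem act_even (ω : ℕ → Fin n → Bool) (u s : ℕ) (κ : ℕ × ℕ) (R : Fin n → ℕ) (l : Fin n) :
    (general n τ).act ((configAt τ ω (2 * u) s κ R).state l) =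
      if s < u / τ then actLaw κ.1 (R l) else PMF.pure Action.idle := by
  by_cases hs : s < u / τ
  · have hcur : s < 2 * u / (2 * τ) := by rwa [even_div]
    have hp : pendingAt τ ω (2 * u) s R l s = R l := by simp [pendingAt, hcur]
    simp only [general, configAt, SenderState.Active, SenderState.cur, hcur, hp, hs, true_and,
      if_true, even_two_mul, actLaw]
  · have hcur : ¬ s < 2 * u / (2 * τ) := by rwa [even_div]
    simp only [general, configAt, SenderState.Active, SenderState.cur, hcur, hs, false_and,
      if_false]

theorem act_odd (ω : ℕ → Fin n → Bool) (u s : ℕ) (κ : ℕ × ℕ) (R : Fin n → ℕ) (l : Fin n) :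
    (general n τ).act ((configAt τ ω (2 * u + 1) s κ R).state l) =
      PMF.pure (if s < u / τ then signalIf (R l) else Action.idle) := by
  by_cases hs : s < u / τ
  · have hcur : s < (2 * u + 1) / (2 * τ) := by rwa [odd_div]
    have hp : pendingAt τ ω (2 * u + 1) s R l s = R l := by simp [pendingAt, hcur]
    have hodd : ¬ Even (2 * u + 1) := by simp
    simp only [general, configAt, SenderState.Active, SenderState.cur, hcur, hp, hs, true_and,
      if_true, hodd, if_false, signalIf]
    split_ifs <;> rfl
  · have hcur : ¬ s < (2 * u + 1) / (2 * τ) := by rwa [odd_div]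
    simp only [general, configAt, SenderState.Active, SenderState.cur, hcur, hs, false_and,
      if_false]

/-- Given the arrivals, the configuration is determined by the progress: all senders agree on the
period that is being scheduled and on the phase. -/
theorem quenched_general_eq (hτ : 0 < τ) (ω : ℕ → Fin n → Bool) (u : ℕ) :
    quenched net α β (general n τ) ω (2 * u) =
      (progress net α β τ ω u).map fun c => configAt τ ω (2 * u) c.1 c.2.1 c.2.2 := by
  induction u with
  | zero =>
    rw [progress, PMF.pure_map, mul_zero, quenched]
    refine congrArg _ (config_ext (fun l => ?_) fun l => ?_)
    · refine (SenderState.mk.injEq ..).mpr ⟨rfl, rfl, ?_, by simp, by simp⟩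
      funext p
      simp [pendingAt, arrived]
    · simp [configAt, pendingAt, arrived]
  | succ u ih =>
    have h2 : 2 * (u + 1) = 2 * u + 1 + 1 := by ring
    rw [h2, quenched, quenched, ih, progress, PMF.bind_map, PMF.bind_bind, PMF.map_bind]
    refine bind_congr_of_support fun c hc => ?_
    obtain ⟨s, κ, R⟩ := c
    obtain ⟨hs, -⟩ := progress_support hτ ω u _ hc
    simp only [Function.comp_apply, act_even, progressStep] at hs ⊢
    by_cases h : s < u / τ
    · simp only [h, if_true]
      rw [map_congr_of_support fun a ha => nextConfig_even hτ ω h κ R ha, PMF.bind_map,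
        PMF.map_comp, ← PMF.bind_pure_comp]
      congr 1
      funext a
      simp only [Function.comp_apply, act_odd, h, if_true]
      rw [independent_pure, PMF.pure_map, nextConfig_odd hτ ω h]
      split_ifs <;> rfl
    · obtain rfl : s = u / τ := le_antisymm hs (not_lt.1 h)
      simp only [h, if_false]
      rw [independent_pure, PMF.pure_map, PMF.pure_map, PMF.pure_bind,
        nextConfig_idle hτ ω (κ' := (0, 0)) (R' := 0) (even_div τ u).symm κ R (fun _ => rfl)
          (fun h' => by rw [odd_div] at h'; exact absurd h' h)]
      simp only [act_odd, h, if_false]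
      rw [independent_pure, PMF.pure_map,
        nextConfig_idle hτ ω (odd_div τ u).symm (0, 0) 0 (fun _ => rfl) (fun _ => rfl)]

end Schedule

/-! ### Completion times of the batches -/

section Completion

variable {X : Type*} [MetricSpace X] {n : ℕ} (net : Network X n) (α β : ℝ) (τ : ℕ)

/-- The law of the completion time of the first `m` batches, in pairs of slots, if the batches are
`b 0, b 1, …` and the time spent on a batch is truncated at `N`. Batch `m` is available at time
`τ * (m + 1)`. -/
def completion (b : ℕ → Fin n → ℕ) (N : ℕ) : ℕ → PMF ℕ
  | 0 => PMF.pure 0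
  | m + 1 => (completion b N m).bind fun D =>
      (resolution net α β N (0, 0) (b m)).map fun r => max D (τ * (m + 1)) + r

/-- The probability that the batches `p, p + 1, …, p + m - 1` are completed after time `x`, if all
earlier batches are completed at time `D`. -/
def overrun (b : ℕ → Fin n → ℕ) (x : ℕ) : ℕ → ℕ → ℕ → ℝ≥0∞
  | 0, _, D => if x < D then 1 else 0
  | m + 1, p, D => ex (resolution net α β (x + 1) (0, 0) (b p)) fun r =>
      overrun b x m (p + 1) (max D (τ * (p + 1)) + r)

/-- The batch of packets that arrive in period `p`. -/
def batchOf (ω : ℕ → Fin n → Bool) (p : ℕ) : Fin n → ℕ := arrived τ ω p (2 * τ * (p + 1))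

variable {net α β τ}

theorem overrun_mono (b : ℕ → Fin n → ℕ) (x m : ℕ) :
    ∀ p, Monotone (overrun net α β τ b x m p) := by
  induction m with
  | zero =>
    intro p D D' h
    simp only [overrun]
    split_ifs
    · exact le_rfl
    · omega
    · exact zero_le
    · exact le_rfl
  | succ m ih =>
    intro p D D' h
    simp only [overrun]
    exact ex_mono fun r => ih (p + 1) (by gcongr)

theorem one_le_overrun (b : ℕ → Fin n → ℕ) {x : ℕ} (m : ℕ) :
    ∀ p {D}, x < D → 1 ≤ overrun net α β τ b x m p D := by
  induction m with
  | zero =>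
    intro p D h
    simp [overrun, h]
  | succ m ih =>
    intro p D h
    simp only [overrun]
    refine (ex_const (resolution net α β (x + 1) (0, 0) (b p)) 1).symm.le.trans
      (ex_mono fun r => ih (p + 1) ?_)
    exact (h.trans_le (le_max_left _ _)).trans_le (Nat.le_add_right _ _)

/-- `overrun` computes the tail of `completion` backwards, from the first batch on. -/
theorem ex_completion_overrun (b : ℕ → Fin n → ℕ) (x m : ℕ) : ∀ p,
    ex (completion net α β τ b (x + 1) p) (overrun net α β τ b x m p) =
      ex (completion net α β τ b (x + 1) (p + m)) fun D => if x < D then 1 else 0 := by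
  induction m with
  | zero => intro p; rfl
  | succ m ih =>
    intro p
    rw [show p + (m + 1) = p + 1 + m by ring, ← ih (p + 1), completion, ex_bind]
    simp only [ex_map]
    rfl

/-- The probability, given the progress at time `u`, that batch `i` is completed after time `x`. -/
def overrunFrom (net : Network X n) (α β : ℝ) (τ : ℕ) (b : ℕ → Fin n → ℕ) (i x u : ℕ)
    (c : Progress n) : ℝ≥0∞ :=
  if c.1 ≤ i then
    if c.1 < u / τ then ex (resolution net α β (x + 1 - u) c.2.1 c.2.2) fun r =>
      overrun net α β τ b x (i - c.1) (c.1 + 1) (u + r)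
    else overrun net α β τ b x (i + 1 - c.1) c.1 u
  else 0

/-- The probability that batch `i` overruns is a supermartingale along the progress. It is not
a martingale only because the service of a batch that is being scheduled is truncated at the time
that is left until `x`, and that of a later batch at `x + 1`. -/
theorem ex_overrunFrom_le (hτ : 0 < τ) (ω : ℕ → Fin n → Bool) {i x u : ℕ} (hu : u < x)
    (c : Progress n) (hc : c.1 ≤ u / τ) :
    ex (progressStep net α β τ ω u c)
      (overrunFrom net α β τ (batchOf τ ω) i x (u + 1)) ≤
      overrunFrom net α β τ (batchOf τ ω) i x u c := by
  obtain ⟨s, κ, R⟩ := c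
  simp only at hc
  have hle : u / τ ≤ (u + 1) / τ := Nat.div_le_div_right (Nat.le_succ u)
  -- A batch whose scheduling starts at time `u + 1` contains exactly the arrivals of its period.
  have hstart : ∀ s', s' ≤ i → s' ≤ (u + 1) / τ → (s' < (u + 1) / τ → τ * (s' + 1) ≤ u + 1) →
      overrunFrom net α β τ (batchOf τ ω) i x (u + 1) (s', (0, 0), arrived τ ω s' (2 * u + 2)) ≤
      overrun net α β τ (batchOf τ ω) x (i + 1 - s') s' (u + 1) := by
    intro s' hi hs' hmax
    simp only [overrunFrom, hi, if_true]
    split_ifs with h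
    · have h1 := hmax h
      have h2 : arrived τ ω s' (2 * u + 2) = batchOf τ ω s' := by
        funext l
        refine arrived_eq_of_le hτ ω ?_ l
        calc 2 * τ * (s' + 1) = 2 * (τ * (s' + 1)) := by ring
          _ ≤ 2 * u + 2 := by omega
      rw [h2, show i + 1 - s' = i - s' + 1 by omega, overrun, max_eq_left h1]
      refine ex_resolution_mono (by omega) _ _ fun r r' hr => ?_
      exact overrun_mono _ _ _ _ (by omega)
    · exact le_rfl
  by_cases hi : s ≤ i
  swap
  · have h0 : ∀ c' ∈ (progressStep net α β τ ω u (s, κ, R)).support,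
        overrunFrom net α β τ (batchOf τ ω) i x (u + 1) c' ≤ 0 := by
      intro c' hc'
      have h1 : ¬ c'.1 ≤ i := by
        unfold progressStep at hc'
        split_ifs at hc' with h
        · rw [PMF.support_map] at hc'
          obtain ⟨a, _, rfl⟩ := hc'
          dsimp only
          split_ifs <;> simp only <;> omega
        · rw [PMF.mem_support_pure_iff] at hc'
          subst hc'
          exact hi
      simp [overrunFrom, h1]
    exact (ex_mono_of_support h0).trans (by rw [ex_const]; exact zero_le)
  unfold progressStep
  simp only
  by_cases h : s < u / τ
  · have h' : s < (u + 1) / τ := h.trans_le hle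
    simp only [h, if_true, ex_map]
    conv_rhs => simp only [overrunFrom, hi, h, if_true]
    rw [show x + 1 - u = x - u + 1 by omega, ex_resolution_succ]
    refine ex_mono fun a => ?_
    split_ifs with h0
    · by_cases hi' : s + 1 ≤ i
      · refine (hstart (s + 1) hi' (by omega) fun h2 => ?_).trans ?_
        · have h3 := (Nat.le_div_iff_mul_le hτ).1 (Nat.succ_le_of_lt h2)
          rw [mul_comm]
          exact h3
        · rw [show i + 1 - (s + 1) = i - s by omega]
      · simp [overrunFrom, hi']
    · simp only [overrunFrom, hi, h', if_true]
      rw [show x + 1 - (u + 1) = x - u by omega]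
      refine ex_mono fun r => ?_
      rw [show u + 1 + r = u + (r + 1) by ring]
  · obtain rfl : s = u / τ := le_antisymm hc (not_lt.1 h)
    simp only [h, if_false, ex_pure]
    refine (hstart (u / τ) hi hle fun h2 => ?_).trans ?_
    · have h3 := (Nat.le_div_iff_mul_le hτ).1 (Nat.succ_le_of_lt h2)
      rw [mul_comm]
      exact h3
    · simp only [overrunFrom, hi, h, if_true, if_false]
      have h4 : u + 1 ≤ τ * (u / τ + 1) := Nat.lt_mul_div_succ u hτ
      rw [show i + 1 - u / τ = i - u / τ + 1 by omega, overrun, overrun, max_eq_right h4,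
        max_eq_right (by omega : u ≤ τ * (u / τ + 1))]

/-- Given the arrivals, batch `i` is unfinished after `2 * x` slots with at most the probability
that the batches `0, …, i`, served one after the other, are completed after time `x`. -/
theorem ex_progress_le (hτ : 0 < τ) (ω : ℕ → Fin n → Bool) (i x : ℕ) :
    ex (progress net α β τ ω x) (fun c => if c.1 ≤ i then 1 else 0) ≤
      ex (completion net α β τ (batchOf τ ω) (x + 1) (i + 1)) fun D => if x < D then 1 else 0 := by
  have h1 : ∀ u ≤ x, ex (progress net α β τ ω u)
      (overrunFrom net α β τ (batchOf τ ω) i x u) ≤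
      ex (completion net α β τ (batchOf τ ω) (x + 1) (i + 1)) fun D => if x < D then 1 else 0 := by
    intro u
    induction u with
    | zero =>
      intro _
      rw [progress, ex_pure]
      have h := ex_completion_overrun (net := net) (α := α) (β := β) (τ := τ) (batchOf τ ω) x
        (i + 1) 0
      rw [zero_add, completion, ex_pure] at h
      rw [← h]
      simp [overrunFrom]
    | succ u ih =>
      intro hu
      refine le_trans ?_ (ih (by omega))
      rw [progress, ex_bind]
      exact ex_mono_of_support fun c hc =>
        ex_overrunFrom_le hτ ω (by omega) c (progress_support hτ ω u c hc).1
  refine le_trans (ex_mono fun c => ?_) (h1 x le_rfl)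
  unfold overrunFrom
  split_ifs with hi hs
  · rw [show x + 1 - x = 0 + 1 by omega, ex_resolution_succ]
    refine (ex_const (independent fun l => actLaw c.2.1.1 (c.2.2 l)) 1).symm.le.trans
      (ex_mono fun a => ?_)
    split_ifs
    · exact one_le_overrun _ _ _ (by omega)
    · rw [resolution, ex_pure]
      exact one_le_overrun _ _ _ (by omega)
  · have h2 : x < τ * (c.1 + 1) :=
      (Nat.lt_mul_div_succ x hτ).trans_le (Nat.mul_le_mul_left _ (by omega))
    rw [show i + 1 - c.1 = i - c.1 + 1 by omega, overrun]
    refine (ex_const (resolution net α β (x + 1) (0, 0) (batchOf τ ω c.1)) 1).symm.le.trans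
      (ex_mono fun r => one_le_overrun _ _ _ ?_)
    exact (h2.trans_le (le_max_right _ _)).trans_le (Nat.le_add_right _ _)
  · exact le_rfl

end Completion

/-! ### Averaging over the arrivals -/

section Annealed

variable {X : Type*} [MetricSpace X] {n : ℕ} (net : Network X n) (α β : ℝ) (τ : ℕ)

/-- The law of the numbers of packets that arrive during `k` slots. -/
def batchLaw (r : Fin n → unitInterval) : ℕ → PMF (Fin n → ℕ)
  | 0 => PMF.pure 0
  | k + 1 => (batchLaw r k).bind fun b =>
      (independent fun l => coin (r l)).map fun arr l => b l + if arr l = true then 1 else 0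

/-- The law of the number of packet slots for the packets of one period, truncated at `N`. -/
def serviceLaw (r : Fin n → unitInterval) (N : ℕ) : PMF ℕ :=
  (batchLaw r (2 * τ)).bind fun b => resolution net α β N (0, 0) b

/-- The law of the completion time of the first `m` batches if the times spent on the batches are
independent with the law `T`. -/
def completionOf (T : PMF ℕ) : ℕ → PMF ℕ
  | 0 => PMF.pure 0
  | m + 1 => (completionOf T m).bind fun D => T.map fun r => max D (τ * (m + 1)) + r

variable {net α β τ}

theorem arrived_congr {ω ω' : ℕ → Fin n → Bool} {p t : ℕ} (h : ∀ u < t, ω u = ω' u) :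
    arrived τ ω p t = arrived τ ω' p t := by
  funext l
  unfold arrived
  congr 1
  refine Finset.filter_congr fun u hu => ?_
  rw [h u (Finset.mem_range.1 hu)]

theorem completion_congr {b b' : ℕ → Fin n → ℕ} (N : ℕ) {m : ℕ} (h : ∀ p < m, b p = b' p) :
    completion net α β τ b N m = completion net α β τ b' N m := by
  induction m with
  | zero => rfl
  | succ m ih =>
    rw [completion, completion, ih fun p hp => h p (hp.trans (Nat.lt_succ_self m)),
      h m (Nat.lt_succ_self m)]

/-- Arrivals that are ignored need not be sampled. -/
theorem arrivals_bind_of_le (r : Fin n → unitInterval) {B : Type*} {m t : ℕ}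
    (F : (ℕ → Fin n → Bool) → PMF B)
    (hF : ∀ ω u arr, m ≤ u → F (Function.update ω u arr) = F ω) (h : m ≤ t) :
    (arrivals r t).bind F = (arrivals r m).bind F := by
  induction h with
  | refl => rfl
  | @step t h ih =>
    rw [arrivals, PMF.bind_bind, ← ih]
    congr 1
    funext ω
    rw [PMF.bind_map]
    have : F ∘ Function.update ω t = fun _ => F ω := funext fun arr => hF ω t arr h
    rw [this, PMF.bind_const]

/-- The arrivals of a period are independent of everything that precedes the period. -/
theorem arrivals_bind_arrived (hτ : 0 < τ) (r : Fin n → unitInterval) {B : Type*} {p : ℕ}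
    (G : (ℕ → Fin n → Bool) → (Fin n → ℕ) → PMF B)
    (hG : ∀ ω u arr, 2 * τ * p ≤ u → G (Function.update ω u arr) = G ω) {k : ℕ} (hk : k ≤ 2 * τ) :
    (arrivals r (2 * τ * p + k)).bind (fun ω => G ω (arrived τ ω p (2 * τ * p + k))) =
      (arrivals r (2 * τ * p)).bind fun ω => (batchLaw r k).bind (G ω) := by
  induction k generalizing G with
  | zero =>
    simp only [add_zero, batchLaw, PMF.pure_bind]
    congr 1
    funext ω
    congr 1
    funext l
    exact arrived_of_lt le_rfl l
  | succ k ih =>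
    have hdiv : (2 * τ * p + k) / (2 * τ) = p := by
      rw [Nat.mul_add_div (by omega), Nat.div_eq_of_lt (by omega), add_zero]
    rw [← add_assoc, arrivals, PMF.bind_bind]
    have h1 : ∀ ω, ((independent fun l => coin (r l)).map fun arr =>
        Function.update ω (2 * τ * p + k) arr).bind
          (fun ω => G ω (arrived τ ω p (2 * τ * p + k + 1))) =
        (fun b => (independent fun l => coin (r l)).bind fun arr =>
          G ω fun l => b l + if arr l = true then 1 else 0) (arrived τ ω p (2 * τ * p + k)) := by
      intro ω
      rw [PMF.bind_map]
      congr 1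
      funext arr
      simp only [Function.comp_apply]
      rw [hG _ _ _ (by omega)]
      congr 1
      funext l
      rw [arrived_succ, hdiv, Function.update_self,
        arrived_congr (ω' := ω) fun u hu => Function.update_of_ne hu.ne _ _]
      simp
    simp only [h1]
    rw [ih (fun ω b => (independent fun l => coin (r l)).bind fun arr =>
      G ω fun l => b l + if arr l = true then 1 else 0) (fun ω u arr hu => by
        simp only [hG ω u arr hu]) (by omega)]
    congr 1
    funext ω
    rw [batchLaw, PMF.bind_bind]
    congr 1
    funext b
    rw [PMF.bind_map]
    rfl

/-- Averaged over the arrivals, the batches are independent and identically distributed. -/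
theorem arrivals_bind_completion (hτ : 0 < τ) (r : Fin n → unitInterval) (N m : ℕ) {t : ℕ}
    (ht : 2 * τ * m ≤ t) :
    ((arrivals r t).bind fun ω => completion net α β τ (batchOf τ ω) N m) =
      completionOf τ (serviceLaw net α β τ r N) m := by
  have hloc : ∀ m (ω : ℕ → Fin n → Bool) u arr, 2 * τ * m ≤ u →
      completion net α β τ (batchOf τ (Function.update ω u arr)) N m =
        completion net α β τ (batchOf τ ω) N m := by
    intro m ω u arr hu
    refine completion_congr N fun p hp => arrived_congr fun v hv => ?_
    refine Function.update_of_ne (ne_of_lt (hv.trans_le (le_trans ?_ hu))) _ _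
    exact Nat.mul_le_mul_left _ hp
  rw [arrivals_bind_of_le r (fun ω => completion net α β τ (batchOf τ ω) N m) (hloc m) ht]
  clear ht
  induction m with
  | zero => simp only [completion, completionOf, PMF.bind_const]
  | succ m ih =>
    simp only [completion, completionOf]
    rw [← ih, show 2 * τ * (m + 1) = 2 * τ * m + 2 * τ by ring]
    have h := arrivals_bind_arrived hτ r (p := m) (k := 2 * τ)
      (fun ω b => (completion net α β τ (batchOf τ ω) N m).bind fun D =>
        (resolution net α β N (0, 0) b).map fun r => max D (τ * (m + 1)) + r)
      (fun ω u arr hu => by simp only [hloc m ω u arr hu]) le_rfl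
    refine Eq.trans ?_ (h.trans ?_)
    · simp only [batchOf, mul_add, mul_one]
    · rw [PMF.bind_bind]
      congr 1
      funext ω
      rw [PMF.bind_comm]
      congr 1
      funext D
      rw [serviceLaw, PMF.map_bind]

end Annealed

/-! ### Stability of the batches -/

section Tail

/-- The tail bound for the delay of the batches. -/
def tailBound (A : ℝ) (z : ℕ) : ℝ := A ^ 2 / (A + z) ^ 2

theorem tailBound_zero {A : ℝ} (hA : 0 < A) : tailBound A 0 = 1 := by
  simp [tailBound, hA.ne']

theorem tailBound_nonneg (A : ℝ) (z : ℕ) : 0 ≤ tailBound A z := by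
  unfold tailBound
  positivity

/-- The increase of the tail bound when a batch of service time `r` is served between two periods: a
tangent bound while `r` is small compared with `A + z`, and the cubic term, which is then at least
`1`, otherwise. -/
theorem tailBound_sub_le {A : ℝ} {τ : ℕ} (hA : 0 < A) (hτA : (τ : ℝ) ≤ A) (z r : ℕ) :
    tailBound A (τ + z - r) + tailBound A z / (A + z) * (3 / 4 * τ) ≤
      tailBound A z + tailBound A z / (A + z) * (6 * r) +
        tailBound A z / (A + z) * (8 / A ^ 2 * r ^ 3) := by
  have hz : (0 : ℝ) ≤ z := Nat.cast_nonneg z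
  have hr : (0 : ℝ) ≤ r := Nat.cast_nonneg r
  have hτ : (0 : ℝ) ≤ τ := Nat.cast_nonneg τ
  set y : ℝ := A + z with hy
  have hy0 : 0 < y := by positivity
  have hyA : A ≤ y := by linarith
  have hx : (τ + z - r : ℝ) ≤ ((τ + z - r : ℕ) : ℝ) := by
    have := Nat.cast_le (α := ℝ).2 (by omega : τ + z ≤ τ + z - r + r)
    push_cast at this
    linarith
  have hψ : tailBound A z = A ^ 2 / y ^ 2 := rfl
  rcases le_or_gt (r : ℝ) (y / 2) with hle | hgt
  · set w : ℝ := y + τ - r with hw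
    have hw0 : 0 < w := by linarith
    have h1 : tailBound A (τ + z - r) ≤ A ^ 2 / w ^ 2 := by
      unfold tailBound
      gcongr
      linarith
    have h2 : y ^ 3 ≤ (y - 3 / 4 * τ + 6 * r) * w ^ 2 := by
      rcases le_or_gt (r : ℝ) τ with he | he
      · have h3 : y ^ 3 ≤ (y - 3 / 4 * (τ - r)) * w ^ 2 := by
          have h4 : 0 ≤ (τ - r : ℝ) := by linarith
          have h5 : (τ - r : ℝ) ≤ y := by linarith
          have h6 : w = y + (τ - r) := by rw [hw]; ring
          rw [h6]
          generalize (τ - r : ℝ) = e at h4 h5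
          have : 0 ≤ e * ((y - e) * (5 / 4 * y + 3 / 4 * e)) := by
            have : 0 ≤ y - e := by linarith
            positivity
          nlinarith
        refine h3.trans ?_
        gcongr
        linarith
      · have h3 : y ^ 3 ≤ (y + 6 * (r - τ)) * w ^ 2 := by
          have h4 : 0 ≤ (r - τ : ℝ) := by linarith
          have h5 : (r - τ : ℝ) ≤ y / 2 := by linarith
          have h6 : w = y - (r - τ) := by rw [hw]; ring
          rw [h6]
          generalize (r - τ : ℝ) = f at h4 h5
          have : 0 ≤ f * ((y - 2 * f) * (4 * y - 3 * f)) := by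
            have h7 : 0 ≤ y - 2 * f := by linarith
            have h8 : 0 ≤ 4 * y - 3 * f := by linarith
            positivity
          nlinarith
        exact h3.trans (mul_le_mul_of_nonneg_right (by linarith) (by positivity))
    have h3 : A ^ 2 / w ^ 2 ≤ A ^ 2 / y ^ 2 + A ^ 2 / y ^ 2 / y * (6 * r) -
        A ^ 2 / y ^ 2 / y * (3 / 4 * τ) := by
      have h4 : A ^ 2 / y ^ 2 + A ^ 2 / y ^ 2 / y * (6 * r) - A ^ 2 / y ^ 2 / y * (3 / 4 * τ) =
          A ^ 2 * (y - 3 / 4 * τ + 6 * r) / y ^ 3 := by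
        field_simp
        ring
      rw [h4, div_le_div_iff₀ (by positivity) (by positivity)]
      calc A ^ 2 * y ^ 3 ≤ A ^ 2 * ((y - 3 / 4 * τ + 6 * r) * w ^ 2) := by gcongr
        _ = _ := by ring
    have h5 : 0 ≤ A ^ 2 / y ^ 2 / y * (8 / A ^ 2 * r ^ 3) := by positivity
    rw [hψ]
    linarith
  · have h1 : tailBound A (τ + z - r) ≤ 1 := by
      unfold tailBound
      rw [div_le_one (by positivity)]
      gcongr
      linarith [Nat.cast_nonneg (α := ℝ) (τ + z - r)]
    have h2 : 1 ≤ A ^ 2 / y ^ 2 / y * (8 / A ^ 2 * r ^ 3) := by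
      have h3 : A ^ 2 / y ^ 2 / y * (8 / A ^ 2 * r ^ 3) = (2 * r / y) ^ 3 := by
        field_simp
        ring
      rw [h3]
      refine one_le_pow₀ ?_
      rw [one_le_div hy0]
      linarith
    have h3 : A ^ 2 / y ^ 2 / y * (3 / 4 * τ) ≤ A ^ 2 / y ^ 2 := by
      rw [div_mul_eq_mul_div, div_le_iff₀ hy0]
      gcongr
      linarith
    have h4 : 0 ≤ A ^ 2 / y ^ 2 / y * (6 * r) := by positivity
    rw [hψ]
    linarith

/-- If the service times are short on average and have a bounded third moment, then the tail bound
does not increase when a batch is served. -/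
theorem ex_tailBound_le {A : ℝ} {τ : ℕ} {T : PMF ℕ} (hτ : 0 < τ) (hτA : (τ : ℝ) ≤ A)
    (h1 : ex T (fun r => (r : ℝ≥0∞)) ≤ ENNReal.ofReal (τ / 16))
    (h3 : ex T (fun r => (r : ℝ≥0∞) ^ 3) ≤ ENNReal.ofReal (A ^ 2 / 32)) (z : ℕ) :
    ex T (fun r => ENNReal.ofReal (tailBound A (τ + z - r))) ≤
      ENNReal.ofReal (tailBound A z) := by
  have hτ1 : (1 : ℝ) ≤ τ := by exact_mod_cast hτ
  have hA : 0 < A := by linarith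
  have hψ := tailBound_nonneg A z
  have hy0 : 0 < A + (z : ℝ) := by positivity
  set c : ℝ := tailBound A z / (A + z) with hc
  have hc0 : 0 ≤ c := by positivity
  have hpt : ∀ r : ℕ, ENNReal.ofReal (tailBound A (τ + z - r)) + ENNReal.ofReal (c * (3 / 4 * τ)) ≤
      ENNReal.ofReal (tailBound A z) + ENNReal.ofReal (c * 6) * r +
        ENNReal.ofReal (c * (8 / A ^ 2)) * (r : ℝ≥0∞) ^ 3 := by
    intro r
    rw [← ENNReal.ofReal_natCast r, ← ENNReal.ofReal_pow (by positivity),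
      ← ENNReal.ofReal_mul (by positivity), ← ENNReal.ofReal_mul (by positivity),
      ← ENNReal.ofReal_add (tailBound_nonneg _ _) (by positivity),
      ← ENNReal.ofReal_add hψ (by positivity),
      ← ENNReal.ofReal_add (by positivity) (by positivity)]
    refine ENNReal.ofReal_le_ofReal ((tailBound_sub_le hA hτA z r).trans (le_of_eq ?_))
    rw [← hc]
    ring
  have hex := ex_mono (p := T) hpt
  rw [ex_add, ex_add, ex_add, ex_const, ex_const, ex_const_mul, ex_const_mul] at hex
  refine (ENNReal.add_le_add_iff_right (a := ENNReal.ofReal (c * (3 / 4 * τ)))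
    ENNReal.ofReal_ne_top).1 (hex.trans ?_)
  calc _ ≤ ENNReal.ofReal (tailBound A z) + ENNReal.ofReal (c * 6) * ENNReal.ofReal (τ / 16) +
        ENNReal.ofReal (c * (8 / A ^ 2)) * ENNReal.ofReal (A ^ 2 / 32) := by gcongr
    _ = ENNReal.ofReal (tailBound A z + c * 6 * (τ / 16) + c * (8 / A ^ 2) * (A ^ 2 / 32)) := by
        rw [ENNReal.ofReal_add (by positivity) (by positivity),
          ENNReal.ofReal_add hψ (by positivity), ENNReal.ofReal_mul (p := c * 6) (by positivity),
          ENNReal.ofReal_mul (p := c * (8 / A ^ 2)) (by positivity)]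
    _ ≤ ENNReal.ofReal (tailBound A z + c * (3 / 4 * τ)) := by
        refine ENNReal.ofReal_le_ofReal ?_
        have h4 : c * (8 / A ^ 2) * (A ^ 2 / 32) = c * (1 / 4) := by
          field_simp
          ring
        rw [h4, add_assoc]
        have h5 : c * 6 * (τ / 16) + c * (1 / 4) = c * (3 / 8 * τ + 1 / 4) := by ring
        rw [h5]
        gcongr
        linarith
    _ = _ := ENNReal.ofReal_add hψ (by positivity)

/-- With at most the probability `tailBound A z`, the first `m` batches are completed more than `z`
after the time `τ * (m + 1)` at which the next batch becomes available. -/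
theorem ex_completionOf_le {A : ℝ} {τ : ℕ} {T : PMF ℕ} (hτ : 0 < τ) (hτA : (τ : ℝ) ≤ A)
    (h1 : ex T (fun r => (r : ℝ≥0∞)) ≤ ENNReal.ofReal (τ / 16))
    (h3 : ex T (fun r => (r : ℝ≥0∞) ^ 3) ≤ ENNReal.ofReal (A ^ 2 / 32)) (m : ℕ) : ∀ z : ℕ,
    ex (completionOf τ T m) (fun D => if τ * (m + 1) + z < D then 1 else 0) ≤
      ENNReal.ofReal (tailBound A z) := by
  have hA : 0 < A := lt_of_lt_of_le (by exact_mod_cast hτ) hτA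
  induction m with
  | zero =>
    intro z
    simp [completionOf, ex_pure]
  | succ m ih =>
    intro z
    rw [completionOf, ex_bind]
    simp only [ex_map]
    rw [ex_comm]
    refine le_trans (ex_mono fun r => ?_) (ex_tailBound_le hτ hτA h1 h3 z)
    rcases Nat.lt_or_ge (τ + z) r with h | h
    · rw [show τ + z - r = 0 by omega, tailBound_zero hA, ENNReal.ofReal_one]
      refine le_trans (ex_mono (g := fun _ => 1) fun D => ?_) (ex_const _ 1).le
      split_ifs <;> simp
    · refine le_trans (ex_mono fun D => ?_) (ih (τ + z - r))
      have h4 : τ * (m + 1 + 1) = τ * (m + 1) + τ := by ring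
      split_ifs with h5 h6
      · exact le_rfl
      · exfalso
        rcases max_cases D (τ * (m + 1)) with ⟨h7, _⟩ | ⟨h7, _⟩ <;> rw [h7] at h5 <;>
          omega
      · exact zero_le
      · exact le_rfl

end Tail

/-! ### Stability of the queues -/

section Stability

variable {X : Type*} [MetricSpace X] {n : ℕ} {net : Network X n} {α β : ℝ} {τ : ℕ}

theorem pendingAt_le (hτ : 0 < τ) (ω : ℕ → Fin n → Bool) (t s : ℕ) {R : Fin n → ℕ} {l : Fin n}
    (hR : R l ≤ 2 * τ) (p : ℕ) :
    pendingAt τ ω t s R l p ≤ 2 * τ * if s ≤ p then 1 else 0 := by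
  unfold pendingAt
  split_ifs with h1 h2 h3
  · omega
  · omega
  · simpa using hR
  · omega
  · simpa using arrived_le hτ ω p t l
  · omega

theorem ex_law_even_le (hτ : 0 < τ) (r : Fin n → unitInterval) (x : ℕ) (l : Fin n) :
    ex (law net α β (general n τ) r (2 * x)) (fun c => (c.queue l : ℝ≥0∞)) ≤
      2 * τ * (1 + ∑ p ∈ Finset.range (x / τ),
        ex (completionOf τ (serviceLaw net α β τ r (x + 1)) (p + 1))
          fun D => if x < D then 1 else 0) := by
  rw [law_eq_bind_quenched, ex_bind]
  simp only [quenched_general_eq hτ, ex_map]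
  have h1 : ∀ ω, ex (progress net α β τ ω x)
      (fun c => ((configAt τ ω (2 * x) c.1 c.2.1 c.2.2).queue l : ℝ≥0∞)) ≤
      2 * τ * (1 + ∑ p ∈ Finset.range (x / τ),
        ex (completion net α β τ (batchOf τ ω) (x + 1) (p + 1))
          fun D => if x < D then 1 else 0) := by
    intro ω
    calc _ ≤ ex (progress net α β τ ω x) fun c => 2 * τ *
          ∑ p ∈ Finset.range (x / τ + 1), if c.1 ≤ p then (1 : ℝ≥0∞) else 0 := by
          refine ex_mono_of_support fun c hc => ?_
          rw [Finset.mul_sum]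
          simp only [configAt, even_div]
          push_cast
          refine Finset.sum_le_sum fun p _ => ?_
          have := pendingAt_le hτ ω (2 * x) c.1 ((progress_support hτ ω x c hc).2 l) p
          calc ((pendingAt τ ω (2 * x) c.1 c.2.2 l p : ℕ) : ℝ≥0∞)
              ≤ ((2 * τ * if c.1 ≤ p then 1 else 0 : ℕ) : ℝ≥0∞) := by exact_mod_cast this
            _ = _ := by push_cast; rfl
      _ = 2 * τ * ∑ p ∈ Finset.range (x / τ + 1),
          ex (progress net α β τ ω x) fun c => if c.1 ≤ p then (1 : ℝ≥0∞) else 0 := by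
          rw [ex_const_mul, ex_sum]
      _ ≤ _ := by
          rw [Finset.sum_range_succ, add_comm]
          gcongr with p
          · refine le_trans (ex_mono (g := fun _ => 1) fun c => ?_) (ex_const _ 1).le
            split_ifs <;> simp
          · exact ex_progress_le hτ ω p x
  refine (ex_mono h1).trans ?_
  rw [ex_const_mul, ex_add, ex_const, ex_sum]
  gcongr with p hp
  rw [← arrivals_bind_completion hτ r (x + 1) (p + 1) (t := 2 * x), ex_bind]
  rw [Finset.mem_range] at hp
  calc 2 * τ * (p + 1) ≤ 2 * τ * (x / τ) := Nat.mul_le_mul_left _ hp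
    _ = 2 * (τ * (x / τ)) := mul_assoc _ _ _
    _ ≤ 2 * x := Nat.mul_le_mul_left _ (Nat.mul_div_le x τ)

theorem sum_tailBound_ne_top {A : ℝ} (hA : 1 ≤ A) (hτ : 0 < τ) :
    ∑' j : ℕ, ENNReal.ofReal (tailBound A (τ * j)) ≠ ⊤ := by
  have hs : Summable fun j : ℕ => tailBound A (τ * j) := by
    refine Summable.of_nonneg_of_le (fun j => tailBound_nonneg _ _) (fun j => ?_)
      (((summable_nat_add_iff 1).2
        (Real.summable_one_div_nat_pow.2 one_lt_two)).mul_left (A ^ 2))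
    unfold tailBound
    rw [← mul_one_div]
    gcongr
    have h : (j : ℝ) ≤ ((τ * j : ℕ) : ℝ) := by exact_mod_cast Nat.le_mul_of_pos_left j hτ
    push_cast at h ⊢
    linarith
  exact hs.tsum_ofReal_ne_top

theorem stabilizes_of_moments {A : ℝ} (hτ : 0 < τ) (hτA : (τ : ℝ) ≤ A) (r : Fin n → unitInterval)
    (h1 : ∀ N, ex (serviceLaw net α β τ r N) (fun i => (i : ℝ≥0∞)) ≤ ENNReal.ofReal (τ / 16))
    (h3 : ∀ N, ex (serviceLaw net α β τ r N) (fun i => (i : ℝ≥0∞) ^ 3) ≤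
      ENNReal.ofReal (A ^ 2 / 32)) :
    Stabilizes net α β (general n τ) r := by
  have hA : 1 ≤ A := le_trans (by exact_mod_cast hτ) hτA
  set V : ℝ≥0∞ := 2 * τ * (1 + (1 + ∑' j : ℕ, ENNReal.ofReal (tailBound A (τ * j)))) with hV
  have hVtop : V ≠ ⊤ := by
    have := sum_tailBound_ne_top hA hτ
    rw [hV]
    refine ENNReal.mul_ne_top (ENNReal.mul_ne_top (by simp) (by simp)) ?_
    exact ENNReal.add_ne_top.2 ⟨by simp, ENNReal.add_ne_top.2 ⟨by simp, this⟩⟩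
  intro l
  have heven : ∀ x, ex (law net α β (general n τ) r (2 * x)) (fun c => (c.queue l : ℝ≥0∞)) ≤ V := by
    intro x
    refine (ex_law_even_le hτ r x l).trans ?_
    rw [hV]
    gcongr
    have hterm : ∀ p ∈ Finset.range (x / τ),
        ex (completionOf τ (serviceLaw net α β τ r (x + 1)) (p + 1))
          (fun D => if x < D then 1 else 0) ≤
        ENNReal.ofReal (tailBound A (τ * ((x / τ - 1 - p) - 1))) := by
      intro p hp
      rw [Finset.mem_range] at hp
      rcases Nat.eq_zero_or_pos (x / τ - 1 - p) with h | h
      · rw [h, Nat.zero_sub, mul_zero, tailBound_zero (by linarith), ENNReal.ofReal_one]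
        refine le_trans (ex_mono (g := fun _ => 1) fun c => ?_) (ex_const _ 1).le
        split_ifs <;> simp
      · refine le_trans (ex_mono fun D => ?_)
          (ex_completionOf_le hτ hτA (h1 (x + 1)) (h3 (x + 1)) (p + 1) _)
        have h5 : τ * (p + 1 + 1) + τ * (x / τ - 1 - p - 1) ≤ x := by
          rw [← mul_add, show p + 1 + 1 + (x / τ - 1 - p - 1) = x / τ by omega]
          exact Nat.mul_div_le x τ
        split_ifs <;> first | exact le_rfl | exact zero_le | (exfalso; omega)
    refine (Finset.sum_le_sum hterm).trans ?_
    rw [Finset.sum_range_reflect (fun j => ENNReal.ofReal (tailBound A (τ * (j - 1)))) (x / τ)]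
    refine (Finset.sum_le_sum_of_subset (Finset.range_mono (Nat.le_succ (x / τ)))).trans ?_
    rw [Finset.sum_range_succ', add_comm]
    refine add_le_add ?_ ?_
    · simp [tailBound_zero (show 0 < A by linarith)]
    · simp only [Nat.add_sub_cancel]
      exact ENNReal.sum_le_tsum _
  have hall : ∀ t, expectedQueue net α β (general n τ) r t l ≤ V + 1 := by
    intro t
    rcases Nat.even_or_odd' t with ⟨x, rfl | rfl⟩
    · exact (heven x).trans le_self_add
    · change ex (law net α β (general n τ) r (2 * x + 1)) (fun c => (c.queue l : ℝ≥0∞)) ≤ V + 1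
      rw [law, ex_bind]
      refine le_trans (ex_mono (g := fun c => (c.queue l : ℝ≥0∞) + 1) fun c => ?_) ?_
      · rw [step, ex_bind]
        simp only [ex_map]
        refine le_trans (ex_mono fun a => (ex_mono fun arr => ?_).trans (ex_const _ _).le)
          (ex_const _ ((c.queue l : ℝ≥0∞) + 1)).le
        simp only [nextConfig]
        norm_cast
        split_ifs <;> omega
      · rw [ex_add, ex_const]
        exact add_le_add (heven x) le_rfl
  refine ⟨(V + 1).toNNReal, fun t => ?_⟩
  rw [ENNReal.coe_toNNReal (by simpa using hVtop)]
  exact hall t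

end Stability

/-! ### Moments of the batches -/

section Moments

variable {X : Type*} [MetricSpace X] {n : ℕ} (net : Network X n) (α β : ℝ)

/-- The load that the batch `b` puts on link `v`. -/
def load (b : Fin n → ℕ) (v : Fin n) : ℝ := ∑ w, (b w : ℝ) * (net.weight α β v w).toReal

/-- The exponential potential of a batch, whose logarithm bounds its load on every link. -/
def expLoad (b : Fin n → ℕ) : ℝ := ∑ v, Real.exp (load net α β b v)

variable {net α β}

theorem exp_le_one_add {a : ℝ} (h0 : 0 ≤ a) (h2 : a ≤ 2) : Real.exp a ≤ 1 + 4 * a := by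
  have h := convexOn_exp.2 (Set.mem_univ 0) (Set.mem_univ 2)
    (show 0 ≤ 1 - a / 2 by linarith) (show 0 ≤ a / 2 by linarith) (by ring)
  simp only [smul_eq_mul, mul_zero, zero_add, Real.exp_zero, mul_one] at h
  rw [show a / 2 * 2 = a by ring] at h
  have h3 : Real.exp 2 ≤ 9 := by
    have h4 := Real.exp_one_lt_d9
    have h5 := Real.exp_pos 1
    rw [show (2 : ℝ) = 1 + 1 by norm_num, Real.exp_add]
    nlinarith
  nlinarith

theorem batchLaw_support (r : Fin n → unitInterval) (k : ℕ) {b : Fin n → ℕ}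
    (hb : b ∈ (batchLaw r k).support) (l : Fin n) (hl : 0 < b l) : 0 < (r l : ℝ) := by
  induction k generalizing b with
  | zero =>
    rw [batchLaw, PMF.mem_support_pure_iff] at hb
    subst hb
    simp at hl
  | succ k ih =>
    rw [batchLaw, PMF.mem_support_bind_iff] at hb
    obtain ⟨b', hb', hb⟩ := hb
    rw [PMF.support_map] at hb
    obtain ⟨arr, harr, rfl⟩ := hb
    by_cases h : arr l = true
    · have h1 := mem_support_of_independent harr l
      rw [h, PMF.mem_support_iff, coin_true] at h1
      simpa using h1
    · simp only [h] at hl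
      exact ih hb' (by simpa using hl)

/-- The arrivals are Bernoulli trials, so that weighted sums of them have exponential moments. -/
theorem ex_batchLaw_exp_le (r : Fin n → unitInterval) (a : Fin n → ℝ) (h0 : ∀ w, 0 ≤ a w)
    (h2 : ∀ w, a w ≤ 2) (k : ℕ) :
    ex (batchLaw r k) (fun b => ENNReal.ofReal (Real.exp (∑ w, (b w : ℝ) * a w))) ≤
      ENNReal.ofReal (Real.exp (k * (4 * ∑ w, (r w : ℝ) * a w))) := by
  induction k with
  | zero => simp [batchLaw, ex_pure]
  | succ k ih =>
    rw [batchLaw, ex_bind]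
    simp only [ex_map]
    have h3 : ∀ b : Fin n → ℕ, ex (independent fun l => coin (r l)) (fun arr =>
        ENNReal.ofReal (Real.exp (∑ w, ((b w + if arr w = true then 1 else 0 : ℕ) : ℝ) * a w))) ≤
        ENNReal.ofReal (Real.exp (4 * ∑ w, (r w : ℝ) * a w)) *
          ENNReal.ofReal (Real.exp (∑ w, (b w : ℝ) * a w)) := by
      intro b
      have h4 : ∀ arr : Fin n → Bool, ENNReal.ofReal
          (Real.exp (∑ w, ((b w + if arr w = true then 1 else 0 : ℕ) : ℝ) * a w)) =
          ENNReal.ofReal (Real.exp (∑ w, (b w : ℝ) * a w)) *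
            ∏ w, ENNReal.ofReal (if arr w = true then Real.exp (a w) else 1) := by
        intro arr
        rw [← ENNReal.ofReal_prod_of_nonneg fun w _ => by split_ifs <;> positivity,
          ← ENNReal.ofReal_mul (Real.exp_pos _).le]
        congr 1
        have h5 : ∀ w, (if arr w = true then Real.exp (a w) else 1) =
            Real.exp ((if arr w = true then 1 else 0 : ℝ) * a w) := fun w => by
          split_ifs <;> simp
        simp only [h5]
        rw [← Real.exp_sum, ← Real.exp_add, ← Finset.sum_add_distrib]
        congr 1
        refine Finset.sum_congr rfl fun w _ => ?_
        push_cast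
        ring
      simp only [h4]
      rw [ex_const_mul, mul_comm]
      refine mul_le_mul_left ?_ _
      rw [ex_independent_prod _ fun w x => ENNReal.ofReal (if x = true then Real.exp (a w) else 1),
        Finset.mul_sum, Real.exp_sum, ENNReal.ofReal_prod_of_nonneg fun w _ => (Real.exp_pos _).le]
      refine Finset.prod_le_prod' fun w _ => ?_
      have hr0 := (r w).2.1
      have hr1 := (r w).2.2
      rw [ex_fintype, Fintype.sum_bool, coin_true, coin_false]
      simp only [if_true, Bool.false_eq_true, if_false]
      rw [← ENNReal.ofReal_mul hr0, ← ENNReal.ofReal_mul (by linarith),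
        ← ENNReal.ofReal_add (by positivity) (by linarith)]
      refine ENNReal.ofReal_le_ofReal ?_
      have h6 := exp_le_one_add (h0 w) (h2 w)
      have h7 := Real.add_one_le_exp (4 * ((r w : ℝ) * a w))
      nlinarith
    refine (ex_mono h3).trans ?_
    rw [ex_const_mul]
    refine (mul_le_mul_right ih _).trans ?_
    rw [← ENNReal.ofReal_mul (Real.exp_pos _).le, ← Real.exp_add]
    refine le_of_eq ?_
    push_cast
    ring_nf

theorem ex_expLoad_le (hn : 2 ≤ n) (r : Fin n → unitInterval) (k : ℕ)
    (h : ∀ v, k * (4 * ∑ w, (r w : ℝ) * (net.weight α β v w).toReal) ≤ Real.log n) :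
    ex (batchLaw r k) (fun b => ENNReal.ofReal (expLoad net α β b)) ≤
      ENNReal.ofReal ((n : ℝ) ^ 2) := by
  have hn0 : (0 : ℝ) < n := by positivity
  unfold expLoad load
  simp only [ENNReal.ofReal_sum_of_nonneg fun v _ => (Real.exp_pos _).le]
  rw [ex_sum]
  calc _ ≤ ∑ v : Fin n, ENNReal.ofReal n := by
        refine Finset.sum_le_sum fun v _ => ?_
        refine (ex_batchLaw_exp_le r _ (fun w => ENNReal.toReal_nonneg) (fun w => ?_) k).trans ?_
        · exact ENNReal.toReal_le_of_le_ofReal (by norm_num)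
            ((Network.weight_le_two v w).trans (by simp))
        · refine ENNReal.ofReal_le_ofReal ?_
          rw [← Real.le_log_iff_exp_le hn0]
          exact h v
    _ = _ := by
        rw [Finset.sum_const, Finset.card_univ, Fintype.card_fin, nsmul_eq_mul,
          ← ENNReal.ofReal_natCast, ← ENNReal.ofReal_mul hn0.le]
        congr 1
        ring

theorem load_nonneg (b : Fin n → ℕ) (v : Fin n) : 0 ≤ load net α β b v :=
  Finset.sum_nonneg fun _ _ => mul_nonneg (Nat.cast_nonneg _) ENNReal.toReal_nonneg

theorem weight_ne_top (v w : Fin n) : net.weight α β v w ≠ ⊤ :=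
  ne_top_of_le_ne_top (by simp) (Network.weight_le_two v w)

theorem le_expLoad (b : Fin n → ℕ) : (n : ℝ) ≤ expLoad net α β b := by
  unfold expLoad
  calc (n : ℝ) = ∑ v : Fin n, (1 : ℝ) := by simp
    _ ≤ _ := Finset.sum_le_sum fun v _ => Real.one_le_exp (load_nonneg b v)

theorem load_le_log (b : Fin n → ℕ) (v : Fin n) :
    load net α β b v ≤ Real.log (expLoad net α β b) := by
  have h : Real.exp (load net α β b v) ≤ expLoad net α β b :=
    Finset.single_le_sum (f := fun v => Real.exp (load net α β b v))
      (fun _ _ => (Real.exp_pos _).le) (Finset.mem_univ v)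
  exact (Real.le_log_iff_exp_le ((Real.exp_pos _).trans_le h)).2 h

theorem hasLoad_log (b : Fin n → ℕ) (hb : ∀ l, 0 < b l → net.Reachable α β l) :
    HasLoad net α β b (Real.log (expLoad net α β b)) := by
  refine ⟨hb, fun v => ?_⟩
  refine le_trans (le_of_eq ?_) (ENNReal.ofReal_le_ofReal (load_le_log b v))
  unfold load
  rw [ENNReal.ofReal_sum_of_nonneg fun w _ => mul_nonneg (Nat.cast_nonneg _) ENNReal.toReal_nonneg]
  refine Finset.sum_congr rfl fun w _ => ?_
  rw [ENNReal.ofReal_mul (Nat.cast_nonneg _), ENNReal.ofReal_natCast,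
    ENNReal.ofReal_toReal (weight_ne_top v w)]

theorem total_le_log (b : Fin n → ℕ) :
    total b ≤ ENNReal.ofReal (n * Real.log (expLoad net α β b)) := by
  have h : ∀ l, (b l : ℝ) ≤ Real.log (expLoad net α β b) := fun l => by
    refine le_trans ?_ (load_le_log b l)
    have h1 : (b l : ℝ) = b l * (net.weight α β l l).toReal := by simp [Network.weight]
    rw [h1]
    exact Finset.single_le_sum (f := fun w => (b w : ℝ) * (net.weight α β l w).toReal)
      (fun w _ => mul_nonneg (Nat.cast_nonneg _) ENNReal.toReal_nonneg) (Finset.mem_univ l)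
  unfold total
  calc ∑ l, (b l : ℝ≥0∞) ≤ ∑ l : Fin n, ENNReal.ofReal (Real.log (expLoad net α β b)) := by
        refine Finset.sum_le_sum fun l _ => ?_
        rw [← ENNReal.ofReal_natCast]
        exact ENNReal.ofReal_le_ofReal (h l)
    _ = _ := by
        rw [Finset.sum_const, Finset.card_univ, Fintype.card_fin, nsmul_eq_mul,
          ENNReal.ofReal_mul (Nat.cast_nonneg _), ENNReal.ofReal_natCast]

end Moments

/-! ### Moments of the time to serve the arrivals of a period -/

section Moments

variable {X : Type*} [MetricSpace X] {n : ℕ} {net : Network X n} {α β : ℝ}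

theorem log_gt_of_two_le (hn : 2 ≤ n) : 0.69 < Real.log n :=
  lt_of_lt_of_le (by linarith [Real.log_two_gt_d9])
    (Real.log_le_log two_pos (by exact_mod_cast hn))

/-- A phase in which the packets shrink in every slot lasts long enough to shrink them by a factor
of `n ^ 4`. -/
theorem shrink_pow_phaseLength_le (hn : 2 ≤ n) (k : ℕ) :
    shrink k ^ phaseLength n k ≤ ENNReal.ofReal (1 / (n : ℝ) ^ 4) := by
  have hn0 : (0 : ℝ) < n := by positivity
  have h2 : (1 : ℝ) ≤ 2 ^ k := one_le_pow₀ one_le_two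
  have hq : (1 : ℝ) / (4 * 2 ^ k) / 2 ≤ 1 := by
    rw [div_div, div_le_one (by positivity)]
    linarith
  unfold shrink
  rw [← ENNReal.ofReal_pow (by linarith)]
  refine ENNReal.ofReal_le_ofReal ?_
  calc (1 - 1 / (4 * 2 ^ k) / 2 : ℝ) ^ phaseLength n k
      ≤ Real.exp (-(1 / (4 * 2 ^ k) / 2)) ^ phaseLength n k := by
        refine pow_le_pow_left₀ (by linarith) ?_ _
        linarith [Real.add_one_le_exp (-((1 : ℝ) / (4 * 2 ^ k) / 2))]
    _ = Real.exp (-(phaseLength n k * (1 / (4 * 2 ^ k) / 2))) := by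
        rw [← Real.exp_nat_mul]
        congr 1
        ring
    _ ≤ Real.exp (-(4 * Real.log n)) := by
        refine Real.exp_le_exp.2 (neg_le_neg ?_)
        calc 4 * Real.log n = 8 * Real.log n * (4 * 2 ^ k) * (1 / (4 * 2 ^ k) / 2) := by
              field_simp
              ring
          _ ≤ _ := by
              gcongr
              exact Nat.le_ceil _
    _ = 1 / (n : ℝ) ^ 4 := by
        rw [Real.exp_neg, show (4 : ℝ) = (4 : ℕ) by norm_num, Real.exp_nat_mul,
          Real.exp_log hn0, one_div]

theorem phaseLength_le (hn : 2 ≤ n) (k : ℕ) :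
    (phaseLength n k : ℝ) ≤ 34 * Real.log n * 2 ^ k := by
  have hl := log_gt_of_two_le hn
  have h2 : (1 : ℝ) ≤ 2 ^ k := one_le_pow₀ one_le_two
  have h := Nat.ceil_lt_add_one (show 0 ≤ 8 * Real.log n * (4 * 2 ^ k) by positivity)
  unfold phaseLength
  nlinarith

theorem sum_phaseLength_le (hn : 2 ≤ n) (k : ℕ) :
    ((∑ i ∈ Finset.range (k + 1), phaseLength n i : ℕ) : ℝ) ≤ 68 * Real.log n * 2 ^ k := by
  have hl := log_gt_of_two_le hn
  induction k with
  | zero =>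
    have := phaseLength_le hn 0
    simp only [zero_add, Finset.range_one, Finset.sum_singleton, pow_zero] at this ⊢
    linarith
  | succ k ih =>
    rw [Finset.sum_range_succ]
    push_cast at ih ⊢
    have := phaseLength_le hn (k + 1)
    rw [pow_succ] at this ⊢
    linarith

section Batch

variable {b : Fin n → ℕ} (hn : 2 ≤ n) (hα : 0 < α) (hb : ∀ l, 0 < b l → net.Reachable α β l)

include hn

theorem log_expLoad_nonneg (b : Fin n → ℕ) : 0 ≤ Real.log (expLoad net α β b) := by
  refine Real.log_nonneg (le_trans ?_ (le_expLoad b))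
  exact_mod_cast le_trans one_le_two hn

theorem exp_log_expLoad (b : Fin n → ℕ) :
    Real.exp (Real.log (expLoad net α β b)) = expLoad net α β b := by
  refine Real.exp_log (lt_of_lt_of_le ?_ (le_expLoad b))
  exact_mod_cast lt_of_lt_of_le two_pos hn

include hα hb

/-- The first phase whose asking probability suits the load has an index of logarithmic size. -/
theorem exists_ex_resolution_le (N : ℕ) : ∃ k₀ : ℕ,
    (2 : ℝ) ^ k₀ ≤ 1 + Real.log (expLoad net α β b) ∧
    ∀ (D : ℝ) (m : ℕ) (g φ : ℕ → ℝ≥0∞), 0 ≤ D → 2 ≤ m → m ≤ 8 → φ 0 = 0 →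
      (∀ k, phaseLength n k * g k ≤ ENNReal.ofReal (D * m ^ k)) →
      (∀ k e, e < ∑ i ∈ Finset.range (k + 1), phaseLength n i → φ (e + 1) ≤ φ e + g k) →
      ex (resolution net α β N (0, 0) b) φ ≤ ENNReal.ofReal (2 * (D * m ^ k₀) *
        (1 + m * (Real.log (expLoad net α β b) / (n : ℝ) ^ 3))) := by
  have hI := log_expLoad_nonneg (net := net) (α := α) (β := β) hn b
  have hload := hasLoad_log b hb
  have htot := total_le_log (net := net) (α := α) (β := β) b
  generalize Real.log (expLoad net α β b) = I at hI hload htot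
  have hn2 : (2 : ℝ) ≤ n := by exact_mod_cast hn
  obtain ⟨k₀, h1, h2⟩ := exists_nat_pow_near (x := 1 + I) (y := 2) (by linarith) one_lt_two
  refine ⟨k₀, h1, fun D m g φ hD hm hm8 hφ0 hg hφ => ?_⟩
  have hmR : (m : ℝ) ≤ 8 := by exact_mod_cast hm8
  have hn4 : (16 : ℝ) ≤ (n : ℝ) ^ 4 := by
    calc (16 : ℝ) = 2 ^ 4 := by norm_num
      _ ≤ _ := by gcongr
  have hpow : ∀ k, ENNReal.ofReal (D * m ^ k) = ENNReal.ofReal D * (m : ℝ≥0∞) ^ k := fun k => by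
    rw [ENNReal.ofReal_mul hD, ENNReal.ofReal_pow (Nat.cast_nonneg _), ENNReal.ofReal_natCast]
  refine (ex_resolution_le (D := ENNReal.ofReal D) (M := m)
    (ε := ENNReal.ofReal (1 / (n : ℝ) ^ 4)) hn hα hload (k₀ := k₀) ?_
    (shrink_pow_phaseLength_le hn) (by exact_mod_cast hm) ?_ (fun k => by rw [← hpow]; exact hg k)
    hφ N).trans ?_
  · rw [pow_succ] at h2
    linarith
  · rw [← ENNReal.ofReal_natCast, show (2 : ℝ≥0∞) = ENNReal.ofReal 2 by simp,
      ← ENNReal.ofReal_mul (by norm_num), ← ENNReal.ofReal_mul (by positivity)]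
    refine ENNReal.ofReal_le_one.2 ?_
    rw [mul_one_div, div_le_one (by positivity)]
    linarith
  · rw [hφ0, zero_add, ← hpow, ENNReal.ofReal_mul (p := 2 * (D * (m : ℝ) ^ k₀)) (by positivity),
      ENNReal.ofReal_mul (p := 2) (by norm_num), ENNReal.ofReal_add (by norm_num) (by positivity),
      ENNReal.ofReal_one, ENNReal.ofReal_ofNat]
    gcongr
    calc _ ≤ ENNReal.ofReal (1 / (n : ℝ) ^ 4) * ENNReal.ofReal (n * I) * m := by gcongr
      _ = _ := by
        rw [← ENNReal.ofReal_natCast, ← ENNReal.ofReal_mul (by positivity),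
          ← ENNReal.ofReal_mul (by positivity)]
        congr 1
        field_simp

theorem ex_resolution_first_moment_le (N : ℕ) :
    ex (resolution net α β N (0, 0) b) (fun i => (i : ℝ≥0∞)) ≤
      ENNReal.ofReal (136 * Real.log n ^ 2 +
        272 * Real.log n / (n : ℝ) ^ 2 * expLoad net α β b) := by
  obtain ⟨k₀, hk, h⟩ := exists_ex_resolution_le hn hα hb N
  have hl := log_gt_of_two_le hn
  have hI := log_expLoad_nonneg (net := net) (α := α) (β := β) hn b
  have hY := exp_log_expLoad (net := net) (α := α) (β := β) hn b
  refine (h (34 * Real.log n) 2 (fun _ => 1) _ (by positivity) le_rfl (by norm_num) (by simp)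
    (fun k => ?_) (fun k e _ => by push_cast; rfl)).trans (ENNReal.ofReal_le_ofReal ?_)
  · rw [mul_one, ← ENNReal.ofReal_natCast]
    exact ENNReal.ofReal_le_ofReal (by exact_mod_cast phaseLength_le hn k)
  · set I := Real.log (expLoad net α β b) with hIdef
    set Y := expLoad net α β b
    have hn2 : (2 : ℝ) ≤ n := by exact_mod_cast hn
    have hYpos : 0 < Y := by rw [← hY]; exact Real.exp_pos _
    have a1 : 1 + I ≤ Y / (n : ℝ) ^ 2 + 2 * Real.log n := by
      have := Real.log_le_sub_one_of_pos (show 0 < Y / (n : ℝ) ^ 2 by positivity)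
      rw [Real.log_div hYpos.ne' (by positivity), Real.log_pow] at this
      push_cast at this
      linarith
    have a2 : (1 + I) * I ≤ 2 * Y := by
      have e1 := Real.quadratic_le_exp_of_nonneg hI
      rw [hY] at e1
      nlinarith
    have a3 : 2 * (I / (n : ℝ) ^ 3) * (1 + I) ≤ 2 * (Y / (n : ℝ) ^ 2) := by
      have : 2 * (I / (n : ℝ) ^ 3) * (1 + I) = (2 / n) * ((1 + I) * I) / (n : ℝ) ^ 2 := by
        field_simp
      rw [this, ← mul_div_assoc]
      refine div_le_div_of_nonneg_right ?_ (by positivity)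
      calc 2 / (n : ℝ) * ((1 + I) * I) ≤ 1 * (2 * Y) := by
            refine mul_le_mul ?_ a2 (by positivity) zero_le_one
            rw [div_le_one (by positivity)]
            exact hn2
        _ = _ := one_mul _
    calc _ ≤ 2 * (34 * Real.log n * (1 + I)) * (1 + 2 * (I / (n : ℝ) ^ 3)) := by
          push_cast
          gcongr
      _ = 68 * Real.log n * ((1 + I) + 2 * (I / (n : ℝ) ^ 3) * (1 + I)) := by ring
      _ ≤ 68 * Real.log n * (2 * Real.log n + 4 * (Y / (n : ℝ) ^ 2)) := by
          have : 0 ≤ Y / (n : ℝ) ^ 2 := by positivity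
          refine mul_le_mul_of_nonneg_left ?_ (by positivity)
          linarith
      _ = _ := by ring

theorem ex_resolution_third_moment_le (N : ℕ) :
    ex (resolution net α β N (0, 0) b) (fun i => (i : ℝ≥0∞) ^ 3) ≤
      ENNReal.ofReal (144 * (34 * Real.log n * (3 * (68 * Real.log n) ^ 2)) *
        expLoad net α β b) := by
  obtain ⟨k₀, hk, h⟩ := exists_ex_resolution_le hn hα hb N
  have hl := log_gt_of_two_le hn
  have hI := log_expLoad_nonneg (net := net) (α := α) (β := β) hn b
  have hY := exp_log_expLoad (net := net) (α := α) (β := β) hn b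
  refine (h (34 * Real.log n * (3 * (68 * Real.log n) ^ 2)) 8
    (fun k => ENNReal.ofReal (3 * (68 * Real.log n * 2 ^ k) ^ 2)) _ (by positivity) (by norm_num)
    le_rfl (by simp) (fun k => ?_) (fun k e he => ?_)).trans (ENNReal.ofReal_le_ofReal ?_)
  · rw [← ENNReal.ofReal_natCast, ← ENNReal.ofReal_mul (Nat.cast_nonneg _)]
    refine ENNReal.ofReal_le_ofReal ?_
    calc _ ≤ 34 * Real.log n * 2 ^ k * (3 * (68 * Real.log n * 2 ^ k) ^ 2) := by
          gcongr
          exact phaseLength_le hn k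
      _ = 34 * Real.log n * (3 * (68 * Real.log n) ^ 2) * (2 ^ k) ^ 3 := by ring
      _ = _ := by rw [← pow_mul, mul_comm k, pow_mul]; norm_num
  · have h1 : ((e : ℝ) + 1) ≤ 68 * Real.log n * 2 ^ k :=
      le_trans (by exact_mod_cast he) (sum_phaseLength_le hn k)
    have he0 : (0 : ℝ) ≤ e := Nat.cast_nonneg _
    have hc : ∀ j : ℕ, ((j : ℝ≥0∞)) ^ 3 = ENNReal.ofReal ((j : ℝ) ^ 3) := fun j => by
      rw [ENNReal.ofReal_pow (Nat.cast_nonneg _), ENNReal.ofReal_natCast]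
    rw [hc, hc, ← ENNReal.ofReal_add (by positivity) (by positivity)]
    refine ENNReal.ofReal_le_ofReal ?_
    have h2 : ((e : ℝ) + 1) ^ 2 ≤ (68 * Real.log n * 2 ^ k) ^ 2 := by gcongr
    push_cast
    nlinarith
  · set I := Real.log (expLoad net α β b) with hIdef
    set Y := expLoad net α β b
    have hn2 : (2 : ℝ) ≤ n := by exact_mod_cast hn
    have hn3 : (8 : ℝ) ≤ (n : ℝ) ^ 3 := by
      calc (8 : ℝ) = 2 ^ 3 := by norm_num
        _ ≤ _ := by gcongr
    have a1 : 8 * (I / (n : ℝ) ^ 3) ≤ I := by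
      rw [← mul_div_assoc, div_le_iff₀ (by positivity)]
      nlinarith
    have a2 : (1 + I) ^ 4 ≤ 72 * Y := by
      have e1 := Real.pow_div_factorial_le_exp (1 + I) (by linarith) 4
      rw [Real.exp_add, hY, div_le_iff₀ (by positivity)] at e1
      have e2 := Real.exp_one_lt_d9
      have hYpos : 0 < Y := by rw [← hY]; exact Real.exp_pos _
      norm_num [Nat.factorial] at e1
      nlinarith
    have a3 : (8 : ℝ) ^ k₀ ≤ (1 + I) ^ 3 := by
      calc (8 : ℝ) ^ k₀ = (2 ^ k₀) ^ 3 := by rw [← pow_mul, mul_comm, pow_mul]; norm_num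
        _ ≤ _ := by gcongr
    calc _ ≤ 2 * (34 * Real.log n * (3 * (68 * Real.log n) ^ 2) * (1 + I) ^ 3) * (1 + I) := by
          push_cast
          gcongr
      _ = 2 * (34 * Real.log n * (3 * (68 * Real.log n) ^ 2)) * (1 + I) ^ 4 := by ring
      _ ≤ 2 * (34 * Real.log n * (3 * (68 * Real.log n) ^ 2)) * (72 * Y) := by gcongr
      _ = _ := by ring

end Batch

/-- If the arrivals of a period have logarithmic load in expectation, the period is long enough
for the framework to be stable. -/
theorem stabilizes_of_rate_le {τ : ℕ} (hn : 2 ≤ n) (hα : 0 < α) (r : Fin n → unitInterval)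
    (hr : ∀ l, 0 < (r l : ℝ) → net.Reachable α β l)
    (hload : ∀ v, ((2 * τ : ℕ) : ℝ) * (4 * ∑ w, (r w : ℝ) * (net.weight α β v w).toReal) ≤
      Real.log n)
    (hτ : 10240 * Real.log n ^ 2 ≤ τ) : Stabilizes net α β (general n τ) r := by
  have hl := log_gt_of_two_le hn
  have hn0 : (0 : ℝ) < n := by positivity
  have hτ0 : 0 < τ := by
    have : (0 : ℝ) < τ := lt_of_lt_of_le (by positivity) hτ
    exact_mod_cast this
  have hE := ex_expLoad_le hn r (2 * τ) hload
  -- Moments of the service time follow from moments given the batch that are affine in `expLoad`.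
  have key : ∀ (f : ℕ → ℝ≥0∞) (p q : ℝ), 0 ≤ p → 0 ≤ q →
      (∀ N b, (∀ l, 0 < b l → net.Reachable α β l) → ex (resolution net α β N (0, 0) b) f ≤
        ENNReal.ofReal (p + q * expLoad net α β b)) →
      ∀ N, ex (serviceLaw net α β τ r N) f ≤ ENNReal.ofReal (p + q * (n : ℝ) ^ 2) := by
    intro f p q hp hq h N
    unfold serviceLaw
    rw [ex_bind]
    calc _ ≤ ex (batchLaw r (2 * τ))
          (fun b => ENNReal.ofReal p + ENNReal.ofReal q * ENNReal.ofReal (expLoad net α β b)) := by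
          refine ex_mono_of_support fun b hb => ?_
          have hY : 0 ≤ expLoad net α β b := hn0.le.trans (le_expLoad b)
          rw [← ENNReal.ofReal_mul hq, ← ENNReal.ofReal_add hp (by positivity)]
          exact h N b fun l hbl => hr l (batchLaw_support r _ hb l hbl)
      _ ≤ ENNReal.ofReal p + ENNReal.ofReal q * ENNReal.ofReal ((n : ℝ) ^ 2) := by
          rw [ex_add, ex_const, ex_const_mul]
          gcongr
      _ = _ := by
          rw [← ENNReal.ofReal_mul hq, ← ENNReal.ofReal_add hp (by positivity)]
  set Z : ℝ := 144 * (34 * Real.log n * (3 * (68 * Real.log n) ^ 2)) * (n : ℝ) ^ 2 with hZ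
  have hZ0 : 0 ≤ Z := by positivity
  have hA1 : (1 : ℝ) ≤ τ + 32 * Z := by
    have : (1 : ℝ) ≤ τ := by exact_mod_cast hτ0
    linarith
  refine stabilizes_of_moments (A := τ + 32 * Z) hτ0 (by linarith) r
    (fun N => (key _ (136 * Real.log n ^ 2) (272 * Real.log n / (n : ℝ) ^ 2) (by positivity)
      (by positivity) (fun N b hb => ex_resolution_first_moment_le hn hα hb N) N).trans
      (ENNReal.ofReal_le_ofReal ?_))
    (fun N => (key _ 0 (144 * (34 * Real.log n * (3 * (68 * Real.log n) ^ 2))) le_rfl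
      (by positivity) (fun N b hb => by
        rw [zero_add]
        exact ex_resolution_third_moment_le hn hα hb N) N).trans
      (ENNReal.ofReal_le_ofReal ?_))
  · rw [div_mul_cancel₀ _ (by positivity)]
    nlinarith
  · rw [zero_add, ← hZ]
    have : (τ : ℝ) + 32 * Z ≤ (τ + 32 * Z) ^ 2 := by nlinarith
    have : (0 : ℝ) ≤ τ := Nat.cast_nonneg _
    linarith

end Moments

/-! ### Rates in the throughput region -/

section Throughput

variable {X : Type*} [MetricSpace X] {n : ℕ} {net : Network X n} {α β : ℝ}

/-- The geometric bound on the weights of feasible sets passes to convex combinations. -/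
theorem convexHull_maximalFeasible_bounds (hn : 2 ≤ n) (hα : 0 < α) (hβ : 1 ≤ β)
    (hm : net.LengthMonotone) (hs : net.SubLinear α) {φ : Fin n → ℝ}
    (hφ : φ ∈ convexHull ℝ (net.maximalFeasibleVectors α β)) :
    (∀ v, ∑ w, φ w * (net.weight α β v w).toReal ≤ 10 * (1 + 3 ^ α) * Real.log n) ∧
      (∀ w, φ w ≤ 1) ∧ ∀ w, ¬ net.Reachable α β w → φ w ≤ 0 := by
  set s : Set (Fin n → ℝ) := {φ |
    (∀ v, ∑ w, φ w * (net.weight α β v w).toReal ≤ 10 * (1 + 3 ^ α) * Real.log n) ∧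
      (∀ w, φ w ≤ 1) ∧ ∀ w, ¬ net.Reachable α β w → φ w ≤ 0}
  suffices h : convexHull ℝ (net.maximalFeasibleVectors α β) ⊆ s from h hφ
  refine convexHull_min ?_ ?_
  · rintro _ ⟨S, hS, rfl⟩
    have hn1 : (1 : ℝ) ≤ n := by exact_mod_cast le_trans one_le_two hn
    have hlog := Real.log_nonneg hn1
    refine ⟨fun v => ?_, fun w => Set.indicator_le_self' (fun _ _ => zero_le_one) w,
      fun w hw => ?_⟩
    · have h := Network.sum_weight_le hn hα hβ hm hs hS.prop v
      have h' := ENNReal.toReal_mono ENNReal.ofReal_ne_top h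
      rw [ENNReal.toReal_ofReal (by positivity),
        ENNReal.toReal_sum fun w _ => weight_ne_top v w] at h'
      refine le_trans (le_of_eq ?_) h'
      classical
      rw [← Finset.sum_subset (Finset.subset_univ S)]
      · refine Finset.sum_congr rfl fun w hw => ?_
        rw [Set.indicator_of_mem (by exact_mod_cast hw), Pi.one_apply, one_mul]
      · intro w _ hw
        rw [Set.indicator_of_notMem (by exact_mod_cast hw), zero_mul]
    · rw [Set.indicator_of_notMem]
      intro hwS
      exact hw (hS.prop.reachable (by exact_mod_cast hwS))
  · rintro x ⟨hx1, hx2, hx3⟩ y ⟨hy1, hy2, hy3⟩ a b ha hb hab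
    refine ⟨fun v => ?_, fun w => ?_, fun w hw => ?_⟩
    · have e : ∑ w, (a • x + b • y) w * (net.weight α β v w).toReal =
          a * ∑ w, x w * (net.weight α β v w).toReal +
            b * ∑ w, y w * (net.weight α β v w).toReal := by
        rw [Finset.mul_sum, Finset.mul_sum, ← Finset.sum_add_distrib]
        refine Finset.sum_congr rfl fun w _ => ?_
        simp only [Pi.add_apply, Pi.smul_apply, smul_eq_mul]
        ring
      rw [e]
      exact (convex_Iic (𝕜 := ℝ) (10 * (1 + 3 ^ α) * Real.log n)) (hx1 v) (hy1 v) ha hb hab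
    · exact (convex_Iic (1 : ℝ)) (hx2 w) (hy2 w) ha hb hab
    · exact (convex_Iic (0 : ℝ)) (hx3 w hw) (hy3 w hw) ha hb hab

end Throughput

end SINR

end

theorem theorem1 (α β : ℝ) (hα : 0 < α) (hβ : 1 ≤ β) :
    ∃ K : ℝ, 0 < K ∧ ∃ c : ℝ, 0 < c ∧ ∀ n : ℕ, 2 ≤ n →
      SINR.IsEfficient.{u} α β n (SINR.general n ⌈K * Real.log n ^ 2⌉₊)
        (c / Real.log n ^ 2) := by
  set C : ℝ := 10 * (1 + 3 ^ α) with hC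
  have hC10 : 10 ≤ C := by
    have : (0 : ℝ) < 3 ^ α := by positivity
    linarith
  refine ⟨10240, by norm_num, 1 / (163840 * C), by positivity, fun n hn X _ net hm hs r hr => ?_⟩
  obtain ⟨r', ⟨hr0, φ, hφ, hrφ⟩, rfl⟩ := hr
  obtain ⟨h1, h2, h3⟩ := SINR.convexHull_maximalFeasible_bounds hn hα hβ hm hs hφ
  have hl := SINR.log_gt_of_two_le hn
  set γ : ℝ := 1 / (163840 * C) / Real.log n ^ 2 with hγ
  have hγ0 : 0 < γ := by positivity
  have hγ1 : γ ≤ 1 := by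
    rw [hγ, div_div, div_le_one (by positivity)]
    nlinarith
  have hmem : ∀ l, (γ • r') l ∈ unitInterval := fun l => by
    simp only [Pi.smul_apply, smul_eq_mul]
    exact ⟨mul_nonneg hγ0.le (hr0 l), mul_le_one₀ hγ1 (hr0 l) ((hrφ l).trans (h2 l))⟩
  refine ⟨hmem, SINR.stabilizes_of_rate_le hn hα _ (fun l hrl => ?_) (fun v => ?_) (Nat.le_ceil _)⟩
  · by_contra hR
    have : r' l ≤ 0 := (hrφ l).trans (h3 l hR)
    simp only [Pi.smul_apply, smul_eq_mul] at hrl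
    nlinarith
  · have hsum : ∑ w, (γ • r') w * (net.weight α β v w).toReal ≤ γ * (C * Real.log n) := by
      calc _ = γ * ∑ w, r' w * (net.weight α β v w).toReal := by
            rw [Finset.mul_sum]
            exact Finset.sum_congr rfl fun w _ => by simp [mul_assoc]
        _ ≤ γ * ∑ w, φ w * (net.weight α β v w).toReal := by
            gcongr with w _
            exact hrφ w
        _ ≤ _ := by
            gcongr
            exact h1 v
    have hτ : (⌈10240 * Real.log n ^ 2⌉₊ : ℝ) ≤ 20480 * Real.log n ^ 2 := by
      have := Nat.ceil_lt_add_one (show 0 ≤ 10240 * Real.log n ^ 2 by positivity)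
      nlinarith
    push_cast
    calc _ ≤ 2 * (20480 * Real.log n ^ 2) * (4 * (γ * (C * Real.log n))) := by
          gcongr
          exact mul_nonneg (by norm_num)
            (Finset.sum_nonneg fun w _ => mul_nonneg (hmem w).1 ENNReal.toReal_nonneg)
      _ = Real.log n := by
          rw [hγ]
          field_simp
          norm_num
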